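/- Let $d\ge 1$, $n\ge 0$, and let $\lambda=(\lambda_1\ge\dots\ge\lambda_k>0)$ be a partition of $n$ with exactly $k\le d$ parts. Label the $n$ tensor factors of $(\mathbb C^d)^{\otimes n}$ by the boxes of the Young diagram of $\lambda$ (left to right, then top to bottom). For a permutation $\pi$ of the boxes let $P_\pi$ be the operator permuting the tensor factors accordingly, let $A_\lambda$ (resp. $B_\lambda$) be the group of permutations preserving every row (resp. column), let $Y_\lambda=\sum_{a\in A_\lambda}P_a\sum_{b\in B_\lambda}\mathrm{sgn}(b)P_b$ be the Young symmetrizer, and let $\Pi^{(\lambda)}_{\mathrm{sym}}=\frac1{|A_\lambda|}\sum_{\pi\in A_\lambda}P_\pi$ be the projector onto the $\lambda$-row-symmetric subspace $\{v: P_\pi v=v\ \forall \pi\in A_\lambda\}$. For $w\in\mathbb Z_{\ge0}^d$ let $V(w)$ be the span of the standard basis vectors $|a_1,\dots,a_n\rangle$ in which each symbol $i\in\{1,\dots,d\}$ occurs exactly $w_i$ times. Let $\mu_H$ be the Haar measure on pure states (the law of $U|0\rangle\langle 0|U^\dagger$ for $U$ Haar random in $U(d)$, where $|0\rangle$ is a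 fixed standard basis vector), and let $\kappa_s=\binom{s+d-1}{d-1}$. The row-symmetric joint measurement $\mathcal M^{(\lambda)}$ is the POVM with elements $$F^{(\lambda)}(\psi_1,\dots,\psi_k)\,d\mu_H^k(\psi_1,\dots,\psi_k),\qquad F^{(\lambda)}(\psi_1,\dots,\psi_k)=\bigotimes_{i=1}^k\kappa_{\lambda_i}\psi_i^{\otimes\lambda_i},$$ where $\psi_i^{\otimes \lambda_i}$ acts on the $i$-th row, together with the "fail" element $I-\Pi^{(\lambda)}_{\mathrm{sym}}$. On the outcome $(\psi_1,\dots,\psi_k)$ put $\Psi=\sum_{i=1}^k(d+\lambda_i)\psi_i$ (and, say, $\Psi=0$ on "fail"). The image of $Y_\lambda$ is contained in the $\lambda$-row-symmetric subspace. Moreover, there are absolute constants $C_1,C_2$ (independent of $d,n,k,\lambda$ and of all the data below) such that the following holds. Let $|\tau\rangle$ be a unit vector lying in some weight subspace $V(w)$ and in the $\lambda$-row-symmetric subspace (for example a unit vector of $V(w)$ in the image of $Y_\lambda$, as produced by the preprocessing step), let $U\in U(d)$, and let $O\in\mathbb C^{d\times d}$ be Hermitian. If $\mathcal M^{(\lambda)}$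 is performed on $U^{\otimes n}|\tau\rangle$, then the outcome law is a probability measure, "fail" has probability $0$, $\mathrm{tr}(O\Psi)$ is almost surely real and square integrable, and $$\mathrm{Var}[\mathrm{tr}(O\Psi)]=\mathbb E[\mathrm{tr}(O\Psi)^2]-\mathbb E[\mathrm{tr}(O\Psi)]^2\le k\,\mathrm{tr}(O^2)+C_1\,n\,\|O^2\|_\infty+C_2\,n^2\,\|O\|_\infty^2,$$ where $\|\cdot\|_\infty$ is the spectral norm. -/

import Mathlib

open MeasureTheory ProbabilityTheory

noncomputable section

namespace RowSymShadow

/-! ### Qudits indexed by the boxes of a Young diagram -/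

/-- The boxes `(i, p)` of the Young diagram with rows of lengths `lam 0, …, lam (k-1)`.
The `n = ∑ i, lam i` qudits are labelled by these boxes: `⟨i, p⟩` is the `p`-th qudit in row `i`. -/
abbrev Box {k : ℕ} (lam : Fin k → ℕ) : Type := Σ i : Fin k, Fin (lam i)

/-- `(ℂ^d)^{⊗ n}` with the qudits labelled by the finite type `B`, in coordinates with respect to
the standard basis vectors `|a⟩`, `a : B → Fin d`. -/
abbrev QuditSpace (B : Type) (d : ℕ) : Type := (B → Fin d) → ℂ

/-- Operators on `(ℂ^d)^{⊗ n}`, as matrices in the standard basis. -/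
abbrev QuditOp (B : Type) (d : ℕ) : Type := Matrix (B → Fin d) (B → Fin d) ℂ

/-- The tensor product `⨂_b M b` of one-qudit operators. -/
def tensorOp {B : Type} [Fintype B] {d : ℕ} (M : B → Matrix (Fin d) (Fin d) ℂ) : QuditOp B d :=
  Matrix.of fun a a' => ∏ b, M b (a b) (a' b)

/-- The operator `P_π`, which sends `|a⟩` to `|a ∘ π⁻¹⟩`. -/
def permOp {B : Type} [Fintype B] [DecidableEq B] {d : ℕ} (π : Equiv.Perm B) : QuditOp B d :=
  Matrix.of fun a a' => if a = a' ∘ π.symm then 1 else 0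

/-- The weight vector of the standard basis vector `|a⟩`: how often each symbol occurs. -/
def weight {B : Type} [Fintype B] {d : ℕ} (a : B → Fin d) : Fin d → ℕ :=
  fun i => (Finset.univ.filter fun b => a b = i).card

/-- The weight subspace `V(w)`, spanned by the standard basis vectors of weight `w`. -/
def weightSpace {B : Type} [Fintype B] [DecidableEq B] {d : ℕ} (w : Fin d → ℕ) :
    Submodule ℂ (QuditSpace B d) :=
  Submodule.span ℂ {v | ∃ a : B → Fin d, weight a = w ∧ v = Pi.single a 1}

/-- The row group `A_λ`: permutations of the boxes that preserve every row. -/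
def rowGroup {k : ℕ} (lam : Fin k → ℕ) : Finset (Equiv.Perm (Box lam)) :=
  Finset.univ.filter fun π => ∀ b, (π b).1 = b.1

/-- The column group `B_λ`: permutations of the boxes that preserve every column. -/
def colGroup {k : ℕ} (lam : Fin k → ℕ) : Finset (Equiv.Perm (Box lam)) :=
  Finset.univ.filter fun π => ∀ b, ((π b).2 : ℕ) = (b.2 : ℕ)

/-- The Young symmetrizer `Y_λ = (∑_{a ∈ A_λ} P_a) (∑_{b ∈ B_λ} sgn(b) P_b)`. -/
def youngSymmetrizer {k : ℕ} (lam : Fin k → ℕ) (d : ℕ) : QuditOp (Box lam) d :=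
  (∑ π ∈ rowGroup lam, permOp π) *
    (∑ σ ∈ colGroup lam, ((Equiv.Perm.sign σ : ℤ) : ℂ) • permOp σ)

/-- The `λ`-row-symmetric subspace: the vectors fixed by `P_π` for every `π ∈ A_λ`. -/
def rowSymSpace {k : ℕ} (lam : Fin k → ℕ) (d : ℕ) : Submodule ℂ (QuditSpace (Box lam) d) where
  carrier := {v | ∀ π ∈ rowGroup lam, (permOp π).mulVec v = v}
  add_mem' := by
    intro v w hv hw π hπ
    rw [Matrix.mulVec_add, hv π hπ, hw π hπ]
  zero_mem' := by
    intro π _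
    exact Matrix.mulVec_zero _
  smul_mem' := by
    intro c v hv π hπ
    rw [Matrix.mulVec_smul, hv π hπ]

/-- `Π_sym^{(λ)} = |A_λ|⁻¹ ∑_{π ∈ A_λ} P_π`, the projector onto the row-symmetric subspace. -/
def rowSymProj {k : ℕ} (lam : Fin k → ℕ) (d : ℕ) : QuditOp (Box lam) d :=
  ((rowGroup lam).card : ℂ)⁻¹ • ∑ π ∈ rowGroup lam, permOp π

/-- The rank-one operator `|φ⟩⟨φ|`. -/
def ketbra {ι : Type} (φ : ι → ℂ) : Matrix ι ι ℂ :=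
  Matrix.vecMulVec φ (star φ)

/-- The density operator of the pure state `U^{⊗ n} |τ⟩`. -/
def rotatedState {B : Type} [Fintype B] [DecidableEq B] {d : ℕ} (U : Matrix.unitaryGroup (Fin d) ℂ)
    (τ : QuditSpace B d) : QuditOp B d :=
  ketbra ((tensorOp fun _ : B => (U : Matrix (Fin d) (Fin d) ℂ)).mulVec τ)

/-! ### Haar random pure states -/

/-- Complex matrices carry the product (equivalently Borel) sigma-algebra of their entries. -/
instance matrixMeasurableSpace (d : ℕ) : MeasurableSpace (Matrix (Fin d) (Fin d) ℂ) :=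
  inferInstanceAs (MeasurableSpace (Fin d → Fin d → ℂ))

instance matrixBorelSpace (d : ℕ) : BorelSpace (Matrix (Fin d) (Fin d) ℂ) :=
  inferInstanceAs (BorelSpace (Fin d → Fin d → ℂ))

instance unitaryCompactSpace (d : ℕ) : CompactSpace (Matrix.unitaryGroup (Fin d) ℂ) := by
  have hcl : IsClosed ((Matrix.unitaryGroup (Fin d) ℂ : Submonoid (Matrix (Fin d) (Fin d) ℂ)) :
      Set (Matrix (Fin d) (Fin d) ℂ)) := isClosed_unitary
  have hc : IsCompact (Set.univ.pi fun _ : Fin d => Set.univ.pi fun _ : Fin d =>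
      Metric.closedBall (0 : ℂ) 1) :=
    isCompact_univ_pi fun _ => isCompact_univ_pi fun _ => isCompact_closedBall 0 1
  have hsub : ((Matrix.unitaryGroup (Fin d) ℂ : Submonoid (Matrix (Fin d) (Fin d) ℂ)) :
      Set (Matrix (Fin d) (Fin d) ℂ)) ⊆
      (Set.univ.pi fun _ : Fin d => Set.univ.pi fun _ : Fin d =>
        Metric.closedBall (0 : ℂ) 1) := by
    intro U hU i _ j _
    simpa using entry_norm_bound_of_unitary hU i j
  exact isCompact_iff_compactSpace.mp (hc.of_isClosed_subset hcl hsub)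

/-- The Haar probability measure `ν_H` on the unitary group `U(d)`. -/
def haarUnitary (d : ℕ) : Measure (Matrix.unitaryGroup (Fin d) ℂ) :=
  Measure.haarMeasure ⊤

/-- The Haar random state measure `μ_H`: the law of the density matrix `U |0⟩⟨0| U†` of a pure
state, for a Haar random unitary `U`. -/
def haarState (d : ℕ) [NeZero d] : Measure (Matrix (Fin d) (Fin d) ℂ) :=
  (haarUnitary d).map fun U : Matrix.unitaryGroup (Fin d) ℂ =>
    (U : Matrix (Fin d) (Fin d) ℂ) * ketbra (Pi.single (0 : Fin d) 1) *
      (U : Matrix (Fin d) (Fin d) ℂ).conjTranspose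

/-! ### The row-symmetric joint measurement and the estimator -/

/-- `κ_s`, the dimension of the symmetric subspace of `s` qudits. -/
def symDim (d s : ℕ) : ℕ := Nat.choose (s + d - 1) (d - 1)

/-- The POVM element `F^{(λ)}(ψ_1, …, ψ_k) = ⨂_i κ_{λ_i} ψ_i^{⊗ λ_i}`. -/
def povmElement {k : ℕ} (lam : Fin k → ℕ) {d : ℕ} (ψ : Fin k → Matrix (Fin d) (Fin d) ℂ) :
    QuditOp (Box lam) d :=
  ((∏ i, symDim d (lam i) : ℕ) : ℂ) • tensorOp fun b : Box lam => ψ b.1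

/-- Measurement outcomes: a tuple `(ψ_1, …, ψ_k)`, or the outcome "fail". -/
abbrev Outcome (k d : ℕ) : Type := (Fin k → Matrix (Fin d) (Fin d) ℂ) ⊕ Unit

/-- The law of the outcome when the row-symmetric joint measurement is performed on the density
operator `ρ` (Born rule): on tuples it has density `tr (F^{(λ)}(ψ) ρ)` with respect to `μ_H^k`, and
"fail" has probability `tr ((I - Π_sym^{(λ)}) ρ)`. -/
def outcomeLaw {k : ℕ} (lam : Fin k → ℕ) (d : ℕ) [NeZero d] (ρ : QuditOp (Box lam) d) :
    Measure (Outcome k d) :=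
  ((Measure.pi fun _ : Fin k => haarState d).withDensity fun ψ =>
      ENNReal.ofReal (povmElement lam ψ * ρ).trace.re).map Sum.inl +
    ENNReal.ofReal ((1 - rowSymProj lam d) * ρ).trace.re • Measure.dirac (Sum.inr ())

/-- The estimator `Ψ = ∑_i (d + λ_i) ψ_i` (by convention `0` on the outcome "fail"). -/
def estimator {k : ℕ} (lam : Fin k → ℕ) (d : ℕ) : Outcome k d → Matrix (Fin d) (Fin d) ℂ
  | Sum.inl ψ => ∑ i, ((d : ℂ) + (lam i : ℂ)) • ψ i
  | Sum.inr _ => 0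

/-- The real random variable `tr (O Ψ)`. -/
def traceEstimator {k : ℕ} (lam : Fin k → ℕ) {d : ℕ} (O : Matrix (Fin d) (Fin d) ℂ) :
    Outcome k d → ℝ :=
  fun ω => (O * estimator lam d ω).trace.re

/-- The spectral norm of a matrix: the operator norm on `ℂ^d` with its Euclidean norm. -/
def specNorm {d : ℕ} (M : Matrix (Fin d) (Fin d) ℂ) : ℝ :=
  ‖Matrix.toEuclideanCLM (𝕜 := ℂ) M‖

end RowSymShadow

end

open RowSymShadow

noncomputable section

namespace RowSymShadow

/-! ### Moments of Haar random vectors -/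

/-! Put `v = U^{⊗n} τ`, again a row-symmetric unit vector, and `φ_i = U_i |0⟩` with independent Haar
random `U_i`. The outcome law is the image of the Haar measure weighted by `∏ κ · |⟨⨂ φ | v⟩|²`,
where each box carries the vector of its row. Everything thus reduces to mixed moments of the
coordinates of the `φ_i`, and these are controlled by one recursion, `moment_extend`, which comes
from differentiating the invariance of the moments under rotations of a single `φ_j`.

The recursion has two consequences. By `reproducing`, `∏ κ` times the moment kernel acts as the
identity on row-symmetric tensors; in particular the density has total mass one. By
`mul_integral_quad`, inserting `⟨φ_i|O|φ_i⟩` under the integral and multiplying by `d + λ_i` amounts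
to applying `tr O + ∑_p O_p` to `v`, with `p` running over row `i`. This explains the weights in the
estimator `X`: with `T = ∑_p O_p` over all boxes, `E X = k tr O + ⟨T⟩`.

Inserting two such factors (`mul_integral_quad_quad`) composes the operators. When both factors
belong to the same row there is an extra term in `O²`, and the natural denominator is `(d + λ_i)(d +
λ_i + 1)`. Replacing the latter by `(d + λ_i)²` only increases the integral of a square, hence `E X²
≤ ⟨(k tr O + T)²⟩ + k tr O² + ⟨∑_p (O²)_p⟩`. Subtracting `(E X)²` leaves at most `k tr O² + ⟨∑_p
(O²)_p⟩ + ⟨T²⟩`, and the triangle inequality over the `n` boxes gives the bound with both constants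
equal to `1`. -/

/-- `k` independent Haar random unitaries. -/
def haarTuple (k d : ℕ) : Measure (Fin k → Matrix.unitaryGroup (Fin d) ℂ) :=
  Measure.pi fun _ => haarUnitary d

instance (d : ℕ) : (haarUnitary d).IsMulLeftInvariant := by
  unfold haarUnitary; infer_instance

instance (d : ℕ) : IsProbabilityMeasure (haarUnitary d) :=
  ⟨by
    have h := Measure.haarMeasure_self
      (K₀ := (⊤ : TopologicalSpace.PositiveCompacts (Matrix.unitaryGroup (Fin d) ℂ)))
    simpa [haarUnitary] using h⟩

instance (d : ℕ) : SecondCountableTopology (Matrix (Fin d) (Fin d) ℂ) :=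
  inferInstanceAs (SecondCountableTopology (Fin d → Fin d → ℂ))

instance (d : ℕ) : SecondCountableTopology (Matrix.unitaryGroup (Fin d) ℂ) :=
  TopologicalSpace.Subtype.secondCountableTopology _

instance (k d : ℕ) : (haarTuple k d).IsMulLeftInvariant := by
  unfold haarTuple; infer_instance

instance (k d : ℕ) : IsProbabilityMeasure (haarTuple k d) := by
  unfold haarTuple; infer_instance

variable {k d : ℕ} [NeZero d] {B : Type} [Fintype B]

/-- The random unit vector `U_i |0⟩`, in coordinates. -/
def hvec (U : Fin k → Matrix.unitaryGroup (Fin d) ℂ) (i : Fin k) (x : Fin d) : ℂ :=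
  (U i : Matrix (Fin d) (Fin d) ℂ) x 0

lemma continuous_hvec (i : Fin k) (x : Fin d) :
    Continuous fun U : Fin k → Matrix.unitaryGroup (Fin d) ℂ => hvec U i x :=
  (continuous_subtype_val.comp (continuous_apply i)).matrix_elem x 0

omit [NeZero d] in
lemma integrable_haarTuple {E : Type*} [NormedAddCommGroup E] [SecondCountableTopology E]
    {f : (Fin k → Matrix.unitaryGroup (Fin d) ℂ) → E}
    (hf : Continuous f) : Integrable f (haarTuple k d) := by
  obtain ⟨C, hC⟩ := (isCompact_range hf).isBounded.exists_norm_le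
  exact Integrable.of_bound hf.aestronglyMeasurable C
    (Filter.Eventually.of_forall fun U => hC _ ⟨U, rfl⟩)

lemma hvec_mul (V U : Fin k → Matrix.unitaryGroup (Fin d) ℂ) (i : Fin k) (x : Fin d) :
    hvec (V * U) i x = ∑ y, (V i : Matrix (Fin d) (Fin d) ℂ) x y * hvec U i y := by
  simp [hvec, Matrix.mul_apply]

lemma sum_hvec_mul_star (U : Fin k → Matrix.unitaryGroup (Fin d) ℂ) (i : Fin k) :
    ∑ x, hvec U i x * star (hvec U i x) = 1 := by
  have h := congrFun (congrFun (Matrix.mem_unitaryGroup_iff'.1 (U i).2) 0) 0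
  rw [Matrix.mul_apply] at h
  simpa [hvec, Matrix.star_apply, mul_comm] using h

/-- The mixed moments `∫ ∏_b φ_{r b}(a_b) conj(φ_{r b}(a'_b))` of independent Haar random vectors
`φ_i`, where the index `b` belongs to the vector `r b`. -/
def moment (r : B → Fin k) (a a' : B → Fin d) : ℂ :=
  ∫ U, (∏ b, hvec U (r b) (a b)) * ∏ b, star (hvec U (r b) (a' b)) ∂haarTuple k d

lemma continuous_prod_hvec (r : B → Fin k) (a : B → Fin d) :
    Continuous fun U : Fin k → Matrix.unitaryGroup (Fin d) ℂ => ∏ b, hvec U (r b) (a b) :=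
  continuous_finsetProd _ fun b _ => continuous_hvec (r b) (a b)

lemma continuous_prod_star_hvec (r : B → Fin k) (a : B → Fin d) :
    Continuous fun U : Fin k → Matrix.unitaryGroup (Fin d) ℂ => ∏ b, star (hvec U (r b) (a b)) :=
  continuous_finsetProd _ fun b _ => (continuous_hvec (r b) (a b)).star

/-- The unconjugated and the conjugated product are commutative separately, so either index function
may be permuted within colors while the other stays fixed. -/
lemma moment_comp_left (r : B → Fin k) (σ : Equiv.Perm B) (hσ : ∀ b, r (σ b) = r b)
    (a a' : B → Fin d) : moment r (a ∘ σ) a' = moment r a a' := by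
  unfold moment
  congr 1; ext U; congr 1
  rw [← Equiv.prod_comp σ fun b => hvec U (r b) (a b)]
  simp [hσ]

lemma moment_comp_right (r : B → Fin k) (σ : Equiv.Perm B) (hσ : ∀ b, r (σ b) = r b)
    (a a' : B → Fin d) : moment r a (a' ∘ σ) = moment r a a' := by
  unfold moment
  congr 1; ext U; congr 1
  rw [← Equiv.prod_comp σ fun b => star (hvec U (r b) (a' b))]
  simp [hσ]

lemma moment_comp_equiv {B' : Type} [Fintype B'] (e : B' ≃ B) (r : B → Fin k)
    (a a' : B → Fin d) : moment (r ∘ e) (a ∘ e) (a' ∘ e) = moment r a a' := by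
  unfold moment
  congr 1; ext U
  rw [← Equiv.prod_comp e fun b => hvec U (r b) (a b),
    ← Equiv.prod_comp e fun b => star (hvec U (r b) (a' b))]
  simp

/-- Left invariance of the Haar tuple, multiplied out so that the dependence on `V` is an explicit
polynomial that can be differentiated. -/
lemma moment_rotate [DecidableEq B] (V : Fin k → Matrix.unitaryGroup (Fin d) ℂ) (r : B → Fin k)
    (a a' : B → Fin d) :
    moment r a a' = ∑ c : B → Fin d, ∑ c' : B → Fin d,
      (∏ b, (V (r b) : Matrix (Fin d) (Fin d) ℂ) (a b) (c b)) *
        (∏ b, star ((V (r b) : Matrix (Fin d) (Fin d) ℂ) (a' b) (c' b))) * moment r c c' := by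
  have h1 : moment r a a' = ∫ U, (∏ b, hvec (V * U) (r b) (a b)) *
      ∏ b, star (hvec (V * U) (r b) (a' b)) ∂haarTuple k d :=
    (integral_mul_left_eq_self (μ := haarTuple k d) (fun U => (∏ b, hvec U (r b) (a b)) *
      ∏ b, star (hvec U (r b) (a' b))) V).symm
  have h2 : ∀ U : Fin k → Matrix.unitaryGroup (Fin d) ℂ, (∏ b, hvec (V * U) (r b) (a b)) *
      ∏ b, star (hvec (V * U) (r b) (a' b)) = ∑ c : B → Fin d, ∑ c' : B → Fin d,
      (∏ b, (V (r b) : Matrix (Fin d) (Fin d) ℂ) (a b) (c b)) *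
        (∏ b, star ((V (r b) : Matrix (Fin d) (Fin d) ℂ) (a' b) (c' b))) *
      ((∏ b, hvec U (r b) (c b)) * ∏ b, star (hvec U (r b) (c' b))) := by
    intro U
    simp only [hvec_mul, star_sum, star_mul']
    rw [Finset.prod_univ_sum, Finset.prod_univ_sum, Finset.sum_mul_sum]
    simp only [Fintype.piFinset_univ, Finset.prod_mul_distrib]
    refine Finset.sum_congr rfl fun c _ => Finset.sum_congr rfl fun c' _ => ?_
    ring
  have hc : ∀ c c' : B → Fin d, Integrable (fun U : Fin k → Matrix.unitaryGroup (Fin d) ℂ =>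
      (∏ b, (V (r b) : Matrix (Fin d) (Fin d) ℂ) (a b) (c b)) *
        (∏ b, star ((V (r b) : Matrix (Fin d) (Fin d) ℂ) (a' b) (c' b))) *
      ((∏ b, hvec U (r b) (c b)) * ∏ b, star (hvec U (r b) (c' b)))) (haarTuple k d) :=
    fun c c' => (integrable_haarTuple
      ((continuous_prod_hvec r c).mul (continuous_prod_star_hvec r c'))).const_mul _
  rw [h1]
  simp only [h2]
  rw [integral_finsetSum _ fun c _ => integrable_finsetSum _ fun c' _ => hc c c']
  refine Finset.sum_congr rfl fun c _ => ?_
  rw [integral_finsetSum _ fun c' _ => hc c c']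
  refine Finset.sum_congr rfl fun c' _ => ?_
  rw [integral_const_mul]
  rfl

/-! ### Infinitesimal invariance -/

section
variable [DecidableEq B]

omit [NeZero d] in
lemma hasDerivAt_prod_entries {N : B → ℝ → Matrix (Fin d) (Fin d) ℂ}
    {N' : B → Matrix (Fin d) (Fin d) ℂ} (h0 : ∀ b, N b 0 = 1)
    (hN : ∀ b x y, HasDerivAt (fun t => N b t x y) (N' b x y) 0) (a c : B → Fin d) :
    HasDerivAt (fun t => ∏ b, N b t (a b) (c b))
      (∑ p, (∏ b ∈ Finset.univ.erase p, if a b = c b then 1 else 0) * N' p (a p) (c p)) 0 := by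
  have h := HasDerivAt.fun_finsetProd (u := Finset.univ) (x := (0 : ℝ))
    (f := fun b t => N b t (a b) (c b)) (f' := fun b => N' b (a b) (c b))
    fun b _ => hN b (a b) (c b)
  simpa [h0, Matrix.one_apply] using h

-- The deltas at all sites other than `p` force `c` to agree with `a` off `p`, leaving only the
-- value at `p` free.
omit [NeZero d] in
lemma sum_erase_delta_mul (a : B → Fin d) (p : B) (g : Fin d → ℂ) (G : (B → Fin d) → ℂ) :
    ∑ c : B → Fin d, (∏ b ∈ Finset.univ.erase p, if a b = c b then 1 else 0) * g (c p) * G c =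
      ∑ x, g x * G (Function.update a p x) := by
  have h : ∀ c : B → Fin d, (∏ b ∈ Finset.univ.erase p, if a b = c b then (1 : ℂ) else 0) =
      ∑ x, if c = Function.update a p x then 1 else 0 := by
    intro c
    rw [Finset.prod_ite_zero]
    by_cases hc : ∀ b ∈ Finset.univ.erase p, a b = c b
    · rw [if_pos hc, Finset.sum_eq_single (c p)]
      · rw [if_pos]
        · simp
        · ext b
          by_cases hb : b = p
          · subst hb; simp
          · simp [hb, hc b (by simp [hb])]
      · intro x _ hx
        rw [if_neg]
        rintro rfl
        simp at hx
      · simp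
    · rw [if_neg hc]
      symm
      refine Finset.sum_eq_zero fun x _ => if_neg ?_
      rintro rfl
      exact hc fun b hb => by simp [(Finset.mem_erase.1 hb).1]
  simp only [h, Finset.sum_mul, ite_mul, one_mul, zero_mul]
  rw [Finset.sum_comm]
  simp

omit [NeZero d] in
open scoped Matrix.Norms.Operator in
lemma hasDerivAt_exp_smul_entry (A : Matrix (Fin d) (Fin d) ℂ) (x y : Fin d) :
    HasDerivAt (fun t : ℝ => NormedSpace.exp (t • A) x y) (A x y) 0 := by
  have h := hasDerivAt_exp_smul_const (𝕂 := ℝ) A (0 : ℝ)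
  rw [zero_smul, NormedSpace.exp_zero, one_mul] at h
  exact hasDerivAt_pi.1 (hasDerivAt_pi.1 h x) y

omit [NeZero d] in
lemma exp_smul_mem_unitaryGroup {A : Matrix (Fin d) (Fin d) ℂ} (hA : A.conjTranspose = -A)
    (t : ℝ) : NormedSpace.exp (t • A) ∈ Matrix.unitaryGroup (Fin d) ℂ := by
  rw [Matrix.mem_unitaryGroup_iff, Matrix.star_eq_conjTranspose, ← Matrix.exp_conjTranspose,
    Matrix.conjTranspose_smul, hA, star_trivial, smul_neg, Matrix.exp_neg]
  exact Matrix.mul_nonsing_inv _ ((Matrix.isUnit_iff_isUnit_det _).1 (Matrix.isUnit_exp _))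

/-- Rotating only the vector `j` along `exp (tA)` leaves the moment constant, so its derivative at
`t = 0` vanishes. Skewness rewrites the conjugated entries of `A` as entries of `-A`, which makes
both sides complex linear in `A`. -/
lemma moment_skew (r : B → Fin k) (j : Fin k) (a a' : B → Fin d)
    {A : Matrix (Fin d) (Fin d) ℂ} (hA : A.conjTranspose = -A) :
    ∑ m, ∑ x, (if r m = j then A (a m) x else 0) * moment r (Function.update a m x) a' =
      ∑ m, ∑ x, (if r m = j then A x (a' m) else 0) * moment r a (Function.update a' m x) := by
  let N : B → ℝ → Matrix (Fin d) (Fin d) ℂ := fun b t =>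
    if r b = j then NormedSpace.exp (t • A) else 1
  let N' : B → Matrix (Fin d) (Fin d) ℂ := fun b => if r b = j then A else 0
  let D : B → ℝ → Matrix (Fin d) (Fin d) ℂ := fun b t => (N b t).map star
  let D' : B → Matrix (Fin d) (Fin d) ℂ := fun b => (N' b).map star
  have hN0 : ∀ b, N b 0 = 1 := fun b => by simp [N]
  have hD0 : ∀ b, D b 0 = 1 := fun b => by simp [D, hN0]
  have hN : ∀ b x y, HasDerivAt (fun t => N b t x y) (N' b x y) 0 := by
    intro b x y
    by_cases hb : r b = j
    · simpa [N, N', hb] using hasDerivAt_exp_smul_entry A x y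
    · simpa [N, N', hb] using hasDerivAt_const (0 : ℝ) ((1 : Matrix (Fin d) (Fin d) ℂ) x y)
  have hD : ∀ b x y, HasDerivAt (fun t => D b t x y) (D' b x y) 0 :=
    fun b x y => (hN b x y).star
  have hrot : ∀ t : ℝ, moment r a a' = ∑ c : B → Fin d, ∑ c' : B → Fin d,
      (∏ b, N b t (a b) (c b)) * (∏ b, D b t (a' b) (c' b)) * moment r c c' := by
    intro t
    let V : Fin k → Matrix.unitaryGroup (Fin d) ℂ := fun i =>
      if i = j then ⟨_, exp_smul_mem_unitaryGroup hA t⟩ else 1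
    have hV : ∀ b, (V (r b) : Matrix (Fin d) (Fin d) ℂ) = N b t := by
      intro b
      by_cases hb : r b = j <;> simp [N, V, hb]
    rw [moment_rotate V r a a']
    simp only [hV]
    rfl
  have hder : HasDerivAt (fun t : ℝ => ∑ c : B → Fin d, ∑ c' : B → Fin d,
      (∏ b, N b t (a b) (c b)) * (∏ b, D b t (a' b) (c' b)) * moment r c c')
      (∑ c : B → Fin d, ∑ c' : B → Fin d,
        ((∑ p, (∏ b ∈ Finset.univ.erase p, if a b = c b then 1 else 0) * N' p (a p) (c p)) *
            (∏ b, D b 0 (a' b) (c' b)) +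
          (∏ b, N b 0 (a b) (c b)) *
            ∑ p, (∏ b ∈ Finset.univ.erase p, if a' b = c' b then 1 else 0) *
              D' p (a' p) (c' p)) * moment r c c') 0 :=
    HasDerivAt.fun_sum fun c _ => HasDerivAt.fun_sum fun c' _ =>
      ((hasDerivAt_prod_entries hN0 hN a c).fun_mul
        (hasDerivAt_prod_entries hD0 hD a' c')).mul_const (moment r c c')
  -- The expanded expression equals the constant `moment r a a'` for every `t`, so the computed
  -- derivative is zero.
  have hzero := hder.unique
    ((hasDerivAt_const (0 : ℝ) (moment r a a')).congr_of_eventuallyEq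
      (Filter.Eventually.of_forall fun t => (hrot t).symm))
  have hone : ∀ a c : B → Fin d, (∏ b, (1 : Matrix (Fin d) (Fin d) ℂ) (a b) (c b)) =
      if a = c then 1 else 0 := by
    intro a c
    simp [Matrix.one_apply, Finset.prod_ite_zero, funext_iff]
  simp only [hN0, hD0, hone, add_mul, Finset.sum_add_distrib, mul_ite, ite_mul, mul_one, one_mul,
    mul_zero, zero_mul, Finset.sum_ite_eq, Finset.mem_univ, if_true] at hzero
  simp only [Finset.sum_mul] at hzero
  have e1 : ∀ p : B, ∑ c : B → Fin d, (∏ b ∈ Finset.univ.erase p, if a b = c b then 1 else 0) *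
      N' p (a p) (c p) * moment r c a' = ∑ x, N' p (a p) x * moment r (Function.update a p x) a' :=
    fun p => sum_erase_delta_mul a p (N' p (a p)) fun c => moment r c a'
  have e2 : ∀ p : B, ∑ c : B → Fin d, (∏ b ∈ Finset.univ.erase p, if a' b = c b then 1 else 0) *
      D' p (a' p) (c p) * moment r a c = ∑ x, D' p (a' p) x * moment r a (Function.update a' p x) :=
    fun p => sum_erase_delta_mul a' p (D' p (a' p)) fun c => moment r a c
  have h2 : ∀ g : (B → Fin d) → (B → Fin d) → ℂ,
      (∑ c, ∑ c', if a = c then g c c' else 0) = ∑ c', g a c' := by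
    intro g
    rw [Finset.sum_comm]
    simp
  rw [h2, Finset.sum_comm, Finset.sum_comm (γ := B → Fin d)] at hzero
  simp only [e1, e2] at hzero
  rw [add_eq_zero_iff_eq_neg] at hzero
  have hN' : ∀ m x, (if r m = j then A (a m) x else 0) = N' m (a m) x := by
    intro m x
    by_cases hm : r m = j <;> simp [N', hm]
  have hD' : ∀ m x, (if r m = j then A x (a' m) else 0) = -D' m (a' m) x := by
    intro m x
    have hA' := congrFun (congrFun hA x) (a' m)
    by_cases hm : r m = j
    · simp only [hm, if_true, D', N', Matrix.map_apply]
      rw [Matrix.conjTranspose_apply, Matrix.neg_apply] at hA'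
      rw [hA', neg_neg]
    · simp [D', N', hm]
  refine (Finset.sum_congr rfl fun m _ => Finset.sum_congr rfl fun x _ => by
    rw [hN' m x]).trans (hzero.trans ?_)
  rw [← Finset.sum_neg_distrib]
  refine Finset.sum_congr rfl fun m _ => ?_
  rw [← Finset.sum_neg_distrib]
  exact Finset.sum_congr rfl fun x _ => by rw [hD' m x, neg_mul]

/-- Infinitesimal unitary invariance of the moments. -/
lemma moment_infinitesimal (r : B → Fin k) (j : Fin k) (a a' : B → Fin d) (z x : Fin d) :
    ∑ m, (if r m = j ∧ a m = z then moment r (Function.update a m x) a' else 0) =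
      ∑ m, (if r m = j ∧ a' m = x then moment r a (Function.update a' m z) else 0) := by
  have key : ∀ A : Matrix (Fin d) (Fin d) ℂ,
    ∑ m, ∑ x, (if r m = j then A (a m) x else 0) * moment r (Function.update a m x) a' =
      ∑ m, ∑ x, (if r m = j then A x (a' m) else 0) * moment r a (Function.update a' m x) := by
    intro A
    have h1 := moment_skew r j a a' (A := A - A.conjTranspose) (by simp)
    have h2 := moment_skew r j a a' (A := Complex.I • (A + A.conjTranspose)) (by
      simp [Matrix.conjTranspose_smul, add_comm])
    -- Complexification: `A = ½(A - A†) + (-i/2)·i(A + A†)`, and both `A - A†` and `i(A + A†)` are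
    -- skew-Hermitian.
    have h3 : ∀ m x, (if r m = j then A (a m) x else 0) =
        2⁻¹ * (if r m = j then (A - A.conjTranspose) (a m) x else 0) +
        (-Complex.I / 2) * (if r m = j then (Complex.I • (A + A.conjTranspose)) (a m) x else 0) := by
      intro m x
      split_ifs
      · simp only [Matrix.sub_apply, Matrix.smul_apply, Matrix.add_apply, smul_eq_mul]
        linear_combination ((A (a m) x + A.conjTranspose (a m) x) / 2) * Complex.I_mul_I
      · simp
    have h4 : ∀ m x, (if r m = j then A x (a' m) else 0) =
        2⁻¹ * (if r m = j then (A - A.conjTranspose) x (a' m) else 0) +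
        (-Complex.I / 2) * (if r m = j then (Complex.I • (A + A.conjTranspose)) x (a' m) else 0) := by
      intro m x
      split_ifs
      · simp only [Matrix.sub_apply, Matrix.smul_apply, Matrix.add_apply, smul_eq_mul]
        linear_combination ((A x (a' m) + A.conjTranspose x (a' m)) / 2) * Complex.I_mul_I
      · simp
    simp only [h3, h4, add_mul, mul_assoc, Finset.sum_add_distrib]
    simp only [← Finset.mul_sum]
    rw [h1, h2]
  -- The stated identity is the case of a matrix unit.
  have h := key (Matrix.single z x 1)
  have e1 : ∀ (P : Prop) [Decidable P] (y : Fin d) (G : Fin d → ℂ),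
      ∑ c, (if P then Matrix.single z x (1 : ℂ) y c else 0) * G c =
        if P ∧ y = z then G x else 0 := by
    intro P _ y G
    by_cases hP : P <;> by_cases hy : y = z <;>
      simp [hP, hy, Matrix.single_apply, eq_comm (a := z)]
  have e2 : ∀ (P : Prop) [Decidable P] (y : Fin d) (G : Fin d → ℂ),
      ∑ c, (if P then Matrix.single z x (1 : ℂ) c y else 0) * G c =
        if P ∧ y = x then G z else 0 := by
    intro P _ y G
    by_cases hP : P <;> by_cases hy : y = x <;>
      simp [hP, hy, Matrix.single_apply, eq_comm (a := x)]
  refine ((Finset.sum_congr rfl fun m _ => ?_).trans h).trans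
    (Finset.sum_congr rfl fun m _ => ?_)
  · exact (e1 (r m = j) (a m) fun c => moment r (Function.update a m c) a').symm
  · exact e2 (r m = j) (a' m) fun c => moment r a (Function.update a' m c)

/-! ### Adding a box -/

-- Exchanging the value of `a` at `p` with the free symbol `y` is an involution on pairs `(a, y)`.
omit [NeZero d] [Fintype B] in
lemma sum_update_swap {M : Type*} [AddCommMonoid M] [Fintype (B → Fin d)] (p : B)
    (F : (B → Fin d) → Fin d → M) :
    ∑ a, ∑ y, F a y = ∑ a, ∑ y, F (Function.update a p y) (a p) := by
  rw [← Fintype.sum_prod_type', ← Fintype.sum_prod_type']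
  refine Fintype.sum_equiv ⟨fun q => (Function.update q.1 p q.2, q.1 p),
    fun q => (Function.update q.1 p q.2, q.1 p), fun q => by simp, fun q => by simp⟩ _ _
    fun q => by simp

/-- Extends an index function by one value. -/
def extend (x : Fin d) (a : B → Fin d) : Option B → Fin d := fun o => o.elim x a

omit [NeZero d] [Fintype B] in
lemma extend_update_none (x y : Fin d) (a : B → Fin d) :
    Function.update (extend x a) none y = extend y a := by
  ext o; cases o <;> simp [extend]

omit [NeZero d] [Fintype B] in
lemma extend_update_some (x y : Fin d) (a : B → Fin d) (p : B) :
    Function.update (extend x a) (some p) y = extend x (Function.update a p y) := by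
  ext o; cases o <;> simp [extend, Function.update_apply]

omit [NeZero d] [Fintype B] in
lemma extend_comp_swap (x : Fin d) (a : B → Fin d) (p : B) :
    extend x a ∘ Equiv.swap none (some p) = extend (a p) (Function.update a p x) := by
  ext o
  rcases o with _ | o
  · simp [extend]
  · by_cases h : o = p
    · subst h; simp [extend]
    · rw [Function.comp_apply, Equiv.swap_apply_of_ne_of_ne (by simp) (by simpa using h)]
      simp [extend, h]

omit [Fintype B] in
lemma elim_swap (r : B → Fin k) {j : Fin k} {p : B} (hp : r p = j) (b : Option B) :
    (Equiv.swap none (some p) b).elim j r = b.elim j r := by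
  rcases b with _ | b
  · simp [hp]
  · by_cases h : b = p
    · subst h; simp [hp]
    · rw [Equiv.swap_apply_of_ne_of_ne (by simp) (by simpa using h)]

-- Contracting the new box produces `∑_z |φ_j(z)|² = 1`.
omit [DecidableEq B] in
lemma sum_moment_extend_self (r : B → Fin k) (j : Fin k) (a a' : B → Fin d) :
    ∑ z, moment (fun o => o.elim j r) (extend z a) (extend z a') = moment r a a' := by
  unfold moment
  rw [← integral_finsetSum _ fun z _ => integrable_haarTuple
    ((continuous_prod_hvec (fun o : Option B => o.elim j r) (extend z a)).fun_mul
      (continuous_prod_star_hvec (fun o : Option B => o.elim j r) (extend z a')))]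
  congr 1; ext U
  simp only [Fintype.prod_option, Option.elim_none, Option.elim_some, extend]
  rw [← one_mul ((∏ b, hvec U (r b) (a b)) * _), ← sum_hvec_mul_star U j, Finset.sum_mul]
  refine Finset.sum_congr rfl fun z _ => ?_
  ring

/-- The number of indices that belong to the vector `j`. -/
def colorCount (r : B → Fin k) (j : Fin k) : ℕ := (Finset.univ.filter fun b => r b = j).card

/-- The recursion for the moments: Gaussian integration by parts on the sphere. -/
lemma moment_extend (r : B → Fin k) (j : Fin k) (x y : Fin d) (a a' : B → Fin d) :
    ((d : ℂ) + colorCount r j) * moment (fun o => o.elim j r) (extend x a) (extend y a') =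
      (if x = y then moment r a a' else 0) +
        ∑ p, if r p = j ∧ a' p = x then moment r a (Function.update a' p y) else 0 := by
  set R : Option B → Fin k := fun o => o.elim j r with hR
  have h := fun z : Fin d => moment_infinitesimal R j (extend z a) (extend y a') z x
  simp only [Fintype.sum_option, extend_update_none, extend_update_some] at h
  -- Summing over `z`, the symbol in the new box, turns the left side into `d + colorCount r j`
  -- copies of one moment: the new box contributes `d` of them, and each old box of color `j` one,
  -- after a swap with the new box.
  have h' := Finset.sum_congr (s₁ := (Finset.univ : Finset (Fin d))) rfl fun z _ => h z
  have l1 : ∀ z p, (if R (some p) = j ∧ extend z a (some p) = z then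
      moment R (extend z (Function.update a p x)) (extend y a') else 0) =
      if z = a p then (if r p = j then moment R (extend x a) (extend y a') else 0) else 0 := by
    intro z p
    by_cases hp : r p = j
    · by_cases hz : z = a p
      · have hs := moment_comp_left R (Equiv.swap none (some p)) (elim_swap r hp)
          (extend x a) (extend y a')
        rw [extend_comp_swap] at hs
        simp only [hz, if_true, hp]
        rw [if_pos ⟨hp, rfl⟩, hs]
      · rw [if_neg hz, if_neg]
        rintro ⟨-, h⟩
        exact hz h.symm
    · rw [if_neg (fun h => hp h.1), if_neg hp, ite_self]
  have l2 : ∀ z p, (if R (some p) = j ∧ extend y a' (some p) = x then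
      moment R (extend z a) (extend y (Function.update a' p z)) else 0) =
      if r p = j ∧ a' p = x then
        moment R (extend z a) (extend z (Function.update a' p y)) else 0 := by
    intro z p
    by_cases hp : r p = j ∧ a' p = x
    · have hs := moment_comp_right R (Equiv.swap none (some p)) (elim_swap r hp.1)
        (extend z a) (extend y (Function.update a' p z))
      rw [extend_comp_swap] at hs
      simpa [hp, R, extend] using hs.symm
    · rw [if_neg hp]
      exact if_neg hp
  have l3 : ∀ z, (if R none = j ∧ extend z a none = z then
      moment R (extend x a) (extend y a') else 0) = moment R (extend x a) (extend y a') :=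
    fun z => if_pos ⟨rfl, rfl⟩
  have l4 : ∀ z, (if R none = j ∧ extend y a' none = x then
      moment R (extend z a) (extend z a') else 0) =
      if x = y then moment R (extend z a) (extend z a') else 0 :=
    fun z => if_congr ⟨fun h => h.2.symm, fun h => ⟨rfl, h.symm⟩⟩ rfl rfl
  simp only [l1, l2, l3, l4, Finset.sum_add_distrib] at h'
  rw [Finset.sum_comm, Finset.sum_comm (γ := Fin d)] at h'
  simp only [Finset.sum_ite_eq', Finset.sum_const, Finset.mem_univ, if_true,
    Finset.sum_ite_irrel, hR, sum_moment_extend_self, Finset.card_univ,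
    Fintype.card_fin, nsmul_eq_mul, ← Finset.sum_filter] at h'
  simp only [mul_zero] at h'
  rw [colorCount, add_mul]
  exact h'

end

end RowSymShadow

end

noncomputable section

namespace RowSymShadow

variable {k d : ℕ} [NeZero d] {B : Type} [Fintype B] [DecidableEq B]

/-! ### The reproducing property -/

/-- The ratio `κ_{s+1} / κ_s = (d + s) / (s + 1)` is exactly what cancels the factors of the moment
recursion in `reproducing`. -/
lemma symDim_succ_mul (s : ℕ) : symDim d (s + 1) * (s + 1) = symDim d s * (d + s) := by
  obtain ⟨e, rfl⟩ := Nat.exists_eq_succ_of_ne_zero (NeZero.ne d)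
  have h := Nat.add_one_mul_choose_eq (s + e) s
  have h1 := Nat.choose_symm_add (a := s) (b := e)
  have h2 := Nat.choose_symm_add (a := s + 1) (b := e)
  simp only [symDim, Nat.succ_eq_add_one, Nat.add_sub_cancel, ← add_assoc]
  rw [← h1, show s + 1 + e = s + e + 1 by ring] at *
  rw [← h2, ← h]
  ring

omit [DecidableEq B] in
lemma colorCount_option (r : B → Fin k) (j i : Fin k) :
    colorCount (fun o : Option B => o.elim j r) i = colorCount r i + if j = i then 1 else 0 := by
  classical
  simp only [colorCount, Finset.card_filter, Fintype.sum_option, Option.elim_none,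
    Option.elim_some]
  exact add_comm _ _

omit [NeZero d] in
lemma sum_extend {M : Type*} [AddCommMonoid M] (F : (Option B → Fin d) → M) :
    ∑ a, F a = ∑ a : B → Fin d, ∑ y, F (extend y a) := by
  rw [← Fintype.sum_prod_type']
  refine Fintype.sum_equiv ⟨fun a => (fun b => a (some b), a none), fun q => extend q.2 q.1,
    fun a => ?_, fun q => ?_⟩ _ _ fun a => ?_
  · ext o; cases o <;> simp [extend]
  · simp [extend]
  · congr 1; ext o; cases o <;> simp [extend]

/-- Invariance under all permutations of the indices that preserve the colors `r`. -/
def ColorSym (r : B → Fin k) (v : (B → Fin d) → ℂ) : Prop :=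
  ∀ σ : Equiv.Perm B, (∀ b, r (σ b) = r b) → ∀ a, v (a ∘ σ) = v a

omit [NeZero d] [Fintype B] [DecidableEq B] in
lemma ColorSym.extend {r : B → Fin k} {j : Fin k} {v : (Option B → Fin d) → ℂ}
    (hv : ColorSym (fun o : Option B => o.elim j r) v) (x : Fin d) :
    ColorSym r fun a => v (extend x a) := by
  intro σ hσ a
  have h := hv (Equiv.optionCongr σ) (by rintro (_ | b) <;> simp [hσ])
    (RowSymShadow.extend x a)
  convert h using 2
  ext o; cases o <;> simp [RowSymShadow.extend]

lemma sum_moment_extend (r : B → Fin k) (j : Fin k) (F : (Option B → Fin d) → ℂ) (x : Fin d)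
    (a : B → Fin d) :
    ((d : ℂ) + colorCount r j) * ∑ a', moment (fun o => o.elim j r) (extend x a) a' * F a' =
      ∑ a', moment r a a' * (F (extend x a') +
        ∑ p, if r p = j then F (extend (a' p) (Function.update a' p x)) else 0) := by
  rw [sum_extend]
  simp only [Finset.mul_sum, ← mul_assoc]
  simp only [moment_extend]
  simp only [add_mul, mul_add, Finset.sum_add_distrib, Finset.mul_sum,
    Finset.sum_mul, ite_mul, mul_ite, mul_zero, zero_mul, Finset.sum_ite_eq, Finset.mem_univ,
    if_true]
  congr 1
  rw [Finset.sum_congr rfl fun y _ => Finset.sum_comm, Finset.sum_comm,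
    Finset.sum_comm (γ := B → Fin d)]
  refine Finset.sum_congr rfl fun p _ => ?_
  rw [sum_update_swap p]
  by_cases hp : r p = j
  · simp only [hp, true_and, if_true, Function.update_self, Function.update_idem,
      Function.update_eq_self, Finset.sum_ite_eq', Finset.mem_univ]
  · simp [hp]

/-- By symmetry of `v`, each swap term in `sum_moment_extend` equals the direct term, so together
there are `colorCount r j + 1` equal contributions. -/
lemma sum_moment_extend_mul {r : B → Fin k} {j : Fin k} {v : (Option B → Fin d) → ℂ}
    (hv : ColorSym (fun o : Option B => o.elim j r) v) (x : Fin d) (a : B → Fin d) :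
    ((d : ℂ) + colorCount r j) *
        ∑ a', moment (fun o => o.elim j r) (extend x a) a' * v a' =
      (colorCount r j + 1) * ∑ a', moment r a a' * v (extend x a') := by
  rw [sum_moment_extend, Finset.mul_sum]
  refine Finset.sum_congr rfl fun a' _ => ?_
  have h : ∀ p, (if r p = j then v (extend (a' p) (Function.update a' p x)) else 0) =
      if r p = j then v (extend x a') else 0 := by
    intro p
    by_cases hp : r p = j
    · rw [if_pos hp, if_pos hp, ← extend_comp_swap, hv _ (elim_swap r hp)]
    · rw [if_neg hp, if_neg hp]
  rw [Finset.sum_congr rfl fun p _ => h p, ← Finset.sum_filter, Finset.sum_const, nsmul_eq_mul,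
    colorCount]
  ring

omit [DecidableEq B] in
lemma prod_symDim_option (r : B → Fin k) (j : Fin k) :
    (∏ i, symDim d (colorCount (fun o : Option B => o.elim j r) i)) * (colorCount r j + 1) =
      (∏ i, symDim d (colorCount r i)) * (d + colorCount r j) := by
  rw [← Finset.mul_prod_erase _ _ (Finset.mem_univ j),
    ← Finset.mul_prod_erase _ (fun i => symDim d (colorCount r i)) (Finset.mem_univ j)]
  have h : ∏ i ∈ Finset.univ.erase j, symDim d (colorCount (fun o : Option B => o.elim j r) i) =
      ∏ i ∈ Finset.univ.erase j, symDim d (colorCount r i) :=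
    Finset.prod_congr rfl fun i hi => by
      rw [colorCount_option, if_neg (Finset.ne_of_mem_erase hi).symm, add_zero]
  have h2 := symDim_succ_mul (d := d) (colorCount r j)
  rw [h, colorCount_option, if_pos rfl, mul_right_comm, h2]
  ring

/-- The kernel `∏ κ · moment` reproduces tensors with the right symmetry. -/
theorem reproducing (r : B → Fin k) {v : (B → Fin d) → ℂ} (hv : ColorSym r v) (a : B → Fin d) :
    ((∏ i, symDim d (colorCount r i) : ℕ) : ℂ) * ∑ a', moment r a a' * v a' = v a := by
  rename_i hF hD
  revert hD r v a
  -- Induction on the boxes: transport along equivalences, no boxes (where the kernel is `1`), and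
  -- one added box. The coloring and the tensor stay quantified, since both change when a box is
  -- removed.
  refine Fintype.induction_empty_option (P := fun B _ => ∀ [DecidableEq B] (r : B → Fin k)
    (v : (B → Fin d) → ℂ), ColorSym r v → ∀ a : B → Fin d,
    ((∏ i, symDim d (colorCount r i) : ℕ) : ℂ) * ∑ a', moment r a a' * v a' = v a) ?_ ?_ ?_ B
  · intro A B _ e ih hD r v hv a
    let _ := Fintype.ofEquiv B e.symm
    classical
    have h := ih (r ∘ e) (fun c => v (c ∘ e.symm)) (fun σ hσ c => by
      have := hv ((e.symm.trans σ).trans e) (fun b => by simpa using hσ (e.symm b)) (c ∘ e.symm)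
      convert this using 2
      ext b; simp) (a ∘ e)
    have hc : ∀ i, colorCount (r ∘ e) i = colorCount r i := fun i => by
      simp only [colorCount, Finset.card_filter]
      exact Equiv.sum_comp e fun b => if r b = i then 1 else 0
    simp only [hc] at h
    convert h using 2
    · refine Fintype.sum_equiv (e.symm.arrowCongr (Equiv.refl (Fin d))) _ _ fun c => ?_
      have hc' : e.symm.arrowCongr (Equiv.refl (Fin d)) c = c ∘ e := by ext b; simp
      rw [hc', moment_comp_equiv]
      congr 2
      ext b; simp
    · ext b; simp
  · intro hD r v hv a
    have : ∀ a' : PEmpty → Fin d, a' = a := fun a' => Subsingleton.elim _ _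
    simp [moment, colorCount, symDim, this]
  · intro B _ ih hD r v hv a
    classical
    have hr : r = fun o => o.elim (r none) (r ∘ some) := by ext o; cases o <;> rfl
    have ha : a = extend (a none) (a ∘ some) := by ext o; cases o <;> rfl
    rw [hr] at hv
    rw [hr, ha]
    have h1 := sum_moment_extend_mul hv (a none) (a ∘ some)
    have h2 := ih (r ∘ some) _ (hv.extend (a none)) (a ∘ some)
    have h3 := congrArg (Nat.cast (R := ℂ)) (prod_symDim_option (d := d) (r ∘ some) (r none))
    simp only [Nat.cast_mul, Nat.cast_add, Nat.cast_one] at h3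
    have h4 : ((colorCount (r ∘ some) (r none) : ℂ) + 1) ≠ 0 := Nat.cast_add_one_ne_zero _
    rw [← h2]
    refine mul_left_cancel₀ h4 ?_
    rw [← mul_assoc, mul_comm ((colorCount (r ∘ some) (r none) : ℂ) + 1), h3, mul_assoc]
    trans ((∏ i, symDim d (colorCount (r ∘ some) i) : ℕ) : ℂ) *
      ((colorCount (r ∘ some) (r none) + 1) *
        ∑ a', moment (r ∘ some) (a ∘ some) a' * v (extend (a none) a'))
    · rw [← h1]
      convert rfl
    · rw [mul_left_comm]

/-! ### Amplitudes and quadratic forms -/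

/-- The amplitude `⟨⨂_b φ_{r b} | v⟩`. -/
def ampl (r : B → Fin k) (v : (B → Fin d) → ℂ) (U : Fin k → Matrix.unitaryGroup (Fin d) ℂ) : ℂ :=
  ∑ a, v a * ∏ b, star (hvec U (r b) (a b))

/-- The sesquilinear form `∫ conj ⟨⨂ φ | u⟩ ⟨⨂ φ | v⟩`. -/
def pair (r : B → Fin k) (u v : (B → Fin d) → ℂ) : ℂ :=
  ∫ U, star (ampl r u U) * ampl r v U ∂haarTuple k d

/-- The expectation value `⟨φ_i | O | φ_i⟩`. -/
def quad (O : Matrix (Fin d) (Fin d) ℂ) (i : Fin k) (U : Fin k → Matrix.unitaryGroup (Fin d) ℂ) :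
    ℂ :=
  ∑ y, ∑ x, O y x * (star (hvec U i y) * hvec U i x)

/-- The operator `O` acting on the tensor factor `p`. -/
def siteOp (O : Matrix (Fin d) (Fin d) ℂ) (p : B) (v : (B → Fin d) → ℂ) (a : B → Fin d) : ℂ :=
  ∑ x, O (a p) x * v (Function.update a p x)

/-- The sum of the operators `O_p` over the tensor factors `p` of color `i`. -/
def rowOp (r : B → Fin k) (O : Matrix (Fin d) (Fin d) ℂ) (i : Fin k) (v : (B → Fin d) → ℂ) :
    (B → Fin d) → ℂ :=
  ∑ p, if r p = i then siteOp O p v else 0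

lemma continuous_ampl (r : B → Fin k) (v : (B → Fin d) → ℂ) : Continuous (ampl r v) :=
  continuous_finsetSum _ fun a _ => continuous_const.mul (continuous_prod_star_hvec r a)

lemma continuous_quad (O : Matrix (Fin d) (Fin d) ℂ) (i : Fin k) : Continuous (quad O i) :=
  continuous_finsetSum _ fun y _ => continuous_finsetSum _ fun x _ =>
    continuous_const.mul ((continuous_hvec i y).star.mul (continuous_hvec i x))

lemma star_ampl_mul_ampl (r : B → Fin k) (u v : (B → Fin d) → ℂ)
    (U : Fin k → Matrix.unitaryGroup (Fin d) ℂ) :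
    star (ampl r u U) * ampl r v U = ∑ a, ∑ a', star (u a) * v a' *
      ((∏ b, hvec U (r b) (a b)) * ∏ b, star (hvec U (r b) (a' b))) := by
  simp only [ampl, star_sum, star_mul', star_prod, star_star]
  rw [Finset.sum_mul_sum]
  refine Finset.sum_congr rfl fun a _ => Finset.sum_congr rfl fun a' _ => ?_
  ring

lemma pair_eq_sum (r : B → Fin k) (u v : (B → Fin d) → ℂ) :
    pair r u v = ∑ a, ∑ a', star (u a) * v a' * moment r a a' := by
  have hi : ∀ a a' : B → Fin d, Integrable (fun U : Fin k → Matrix.unitaryGroup (Fin d) ℂ =>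
      star (u a) * v a' *
        ((∏ b, hvec U (r b) (a b)) * ∏ b, star (hvec U (r b) (a' b)))) (haarTuple k d) :=
    fun a a' => (integrable_haarTuple
      ((continuous_prod_hvec r a).mul (continuous_prod_star_hvec r a'))).const_mul _
  unfold pair
  simp only [star_ampl_mul_ampl]
  rw [integral_finsetSum _ fun a _ => integrable_finsetSum _ fun a' _ => hi a a']
  refine Finset.sum_congr rfl fun a _ => ?_
  rw [integral_finsetSum _ fun a' _ => hi a a']
  refine Finset.sum_congr rfl fun a' _ => ?_
  rw [integral_const_mul]
  rfl

/-- Only the right argument needs the symmetry, because `reproducing` is applied to `v` alone. -/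
lemma prod_symDim_mul_pair (r : B → Fin k) (u : (B → Fin d) → ℂ) {v : (B → Fin d) → ℂ}
    (hv : ColorSym r v) :
    ((∏ i, symDim d (colorCount r i) : ℕ) : ℂ) * pair r u v = ∑ a, star (u a) * v a := by
  rw [pair_eq_sum, Finset.mul_sum]
  refine Finset.sum_congr rfl fun a _ => ?_
  rw [← reproducing r hv a]
  simp only [Finset.mul_sum]
  refine Finset.sum_congr rfl fun a' _ => ?_
  ring

lemma pair_add_right (r : B → Fin k) (u v w : (B → Fin d) → ℂ) :
    pair r u (v + w) = pair r u v + pair r u w := by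
  simp only [pair_eq_sum, Pi.add_apply, mul_add, add_mul, Finset.sum_add_distrib]

/-- The tensor product with a vector in a new tensor factor. -/
def tens (z : Fin d → ℂ) (v : (B → Fin d) → ℂ) (a : Option B → Fin d) : ℂ :=
  z (a none) * v (a ∘ some)

lemma ampl_tens (r : B → Fin k) (j : Fin k) (z : Fin d → ℂ) (v : (B → Fin d) → ℂ)
    (U : Fin k → Matrix.unitaryGroup (Fin d) ℂ) :
    ampl (fun o : Option B => o.elim j r) (tens z v) U =
      (∑ y, z y * star (hvec U j y)) * ampl r v U := by
  simp only [ampl, sum_extend, Fintype.prod_option, tens, extend, Option.elim_none,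
    Option.elim_some, Finset.sum_mul_sum]
  rw [Finset.sum_comm]
  refine Finset.sum_congr rfl fun y _ => Finset.sum_congr rfl fun a _ => ?_
  rw [show extend y a ∘ some = a from rfl]
  ring

/-- A quadratic form in `φ_j` is absorbed by one extra box of color `j`: `φ_j(x)` comes from
tensoring `u` with the basis vector `x`, and the remaining factor from tensoring `v` with column `x`
of `O`. Insertions thereby become forms on a larger tensor space. -/
lemma quad_mul_ampl (r : B → Fin k) (O : Matrix (Fin d) (Fin d) ℂ) (j : Fin k)
    (u v : (B → Fin d) → ℂ) (U : Fin k → Matrix.unitaryGroup (Fin d) ℂ) :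
    quad O j U * (star (ampl r u U) * ampl r v U) =
      ∑ x, star (ampl (fun o : Option B => o.elim j r) (tens (Pi.single x 1) u) U) *
        ampl (fun o : Option B => o.elim j r) (tens (fun y => O y x) v) U := by
  simp only [ampl_tens, quad, Pi.single_apply, ite_mul, one_mul, zero_mul, Finset.sum_ite_eq',
    Finset.mem_univ, if_true, star_mul', star_star]
  rw [Finset.sum_comm, Finset.sum_mul]
  refine Finset.sum_congr rfl fun x _ => ?_
  simp only [Finset.sum_mul, Finset.mul_sum]
  refine Finset.sum_congr rfl fun y _ => ?_
  ring

lemma integral_quad_eq_sum_pair (r : B → Fin k) (O : Matrix (Fin d) (Fin d) ℂ) (j : Fin k)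
    (u v : (B → Fin d) → ℂ) :
    ∫ U, quad O j U * (star (ampl r u U) * ampl r v U) ∂haarTuple k d =
      ∑ x, pair (fun o : Option B => o.elim j r) (tens (Pi.single x 1) u)
        (tens (fun y => O y x) v) := by
  simp only [quad_mul_ampl]
  exact integral_finsetSum _ fun x _ => integrable_haarTuple
    ((continuous_ampl _ _).star.mul (continuous_ampl _ _))

lemma pair_tens (r : B → Fin k) (j : Fin k) (x : Fin d) (u : (B → Fin d) → ℂ)
    (F : (Option B → Fin d) → ℂ) :
    pair (fun o : Option B => o.elim j r) (tens (Pi.single x 1) u) F =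
      ∑ a, star (u a) * ∑ a', moment (fun o => o.elim j r) (extend x a) a' * F a' := by
  rw [pair_eq_sum, sum_extend]
  refine Finset.sum_congr rfl fun a _ => ?_
  rw [Finset.sum_eq_single x]
  · rw [Finset.mul_sum]
    refine Finset.sum_congr rfl fun a' _ => ?_
    simp only [tens, extend, Option.elim_none, Pi.single_eq_same, one_mul]
    rw [show extend x a ∘ some = a from rfl]
    ring
  · intro y _ hy
    simp [tens, extend, hy]
  · simp

/-- After absorbing the form into a new box, `sum_moment_extend` removes that box again: the direct
term gives the trace, and the swap with box `p` gives `O_p`. No symmetry of `u` or `v` is needed. -/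
lemma mul_integral_quad (r : B → Fin k) (O : Matrix (Fin d) (Fin d) ℂ) (i : Fin k)
    (u v : (B → Fin d) → ℂ) :
    ((d : ℂ) + colorCount r i) *
        ∫ U, quad O i U * (star (ampl r u U) * ampl r v U) ∂haarTuple k d =
      pair r u (O.trace • v + rowOp r O i v) := by
  rw [integral_quad_eq_sum_pair, pair_eq_sum]
  simp only [pair_tens]
  rw [Finset.sum_comm, Finset.mul_sum]
  refine Finset.sum_congr rfl fun a _ => ?_
  rw [← Finset.mul_sum, mul_left_comm, Finset.mul_sum]
  simp only [sum_moment_extend, mul_assoc]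
  rw [← Finset.mul_sum, Finset.sum_comm]
  congr 1
  refine Finset.sum_congr rfl fun a' _ => ?_
  rw [← Finset.mul_sum, mul_comm]
  congr 1
  simp only [Finset.sum_add_distrib, Pi.add_apply, Pi.smul_apply, smul_eq_mul, rowOp,
    Finset.sum_apply, Matrix.trace, Matrix.diag_apply, Finset.sum_mul]
  congr 1
  rw [Finset.sum_comm]
  refine Finset.sum_congr rfl fun p _ => ?_
  by_cases hp : r p = i
  · simp only [hp, if_true, siteOp]
    rfl
  · simp [hp]

omit [NeZero d] [Fintype B] in
lemma siteOp_tens_some (O : Matrix (Fin d) (Fin d) ℂ) (p : B) (z : Fin d → ℂ)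
    (v : (B → Fin d) → ℂ) :
    siteOp O (some p) (tens z v) = tens z (siteOp O p v) := by
  ext a
  simp only [siteOp, tens, Finset.mul_sum]
  refine Finset.sum_congr rfl fun x _ => ?_
  have h : Function.update a (some p) x ∘ some = Function.update (a ∘ some) p x := by
    ext b; simp [Function.update_apply]
  rw [h, Function.update_of_ne (by simp)]
  simp only [Function.comp_apply]
  ring

omit [NeZero d] [Fintype B] in
lemma siteOp_tens_none (O : Matrix (Fin d) (Fin d) ℂ) (z : Fin d → ℂ) (v : (B → Fin d) → ℂ) :
    siteOp O none (tens z v) = tens (O.mulVec z) v := by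
  ext a
  simp only [siteOp, tens, Matrix.mulVec, dotProduct, Finset.sum_mul]
  refine Finset.sum_congr rfl fun x _ => ?_
  have h : Function.update a none x ∘ some = a ∘ some := by
    ext b; simp
  rw [h, Function.update_self]
  ring

omit [NeZero d] in
lemma rowOp_tens (r : B → Fin k) (O : Matrix (Fin d) (Fin d) ℂ) (i j : Fin k) (z : Fin d → ℂ)
    (v : (B → Fin d) → ℂ) :
    rowOp (fun o : Option B => o.elim j r) O i (tens z v) =
      tens z (rowOp r O i v) + if j = i then tens (O.mulVec z) v else 0 := by
  rw [rowOp, Fintype.sum_option, add_comm]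
  simp only [siteOp_tens_some, siteOp_tens_none, Option.elim_none, Option.elim_some]
  congr 1
  ext a
  simp only [rowOp, tens, Finset.sum_apply, Finset.mul_sum]
  refine Finset.sum_congr rfl fun p _ => ?_
  split_ifs <;> simp [tens]

/-- The factor for `j` is absorbed into a new box, then `mul_integral_quad` is applied on the
enlarged set of boxes. If `i = j`, the new box itself belongs to row `i`: this raises the
denominator by one and lets `O` act on the columns of `O`, which yields `O * O`. -/
lemma mul_integral_quad_quad (r : B → Fin k) (O : Matrix (Fin d) (Fin d) ℂ) (i j : Fin k)
    (u v : (B → Fin d) → ℂ) :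
    ((d : ℂ) + (colorCount r i + if j = i then 1 else 0 : ℕ)) * ∫ U, quad O i U * (quad O j U *
        (star (ampl r u U) * ampl r v U)) ∂haarTuple k d =
      (∫ U, quad O j U * (star (ampl r u U) *
        ampl r (O.trace • v + rowOp r O i v) U) ∂haarTuple k d) +
      if j = i then ∫ U, quad (O * O) j U * (star (ampl r u U) * ampl r v U) ∂haarTuple k d
        else 0 := by
  simp only [quad_mul_ampl r O j u v, Finset.mul_sum]
  rw [integral_finsetSum _ fun x _ => integrable_haarTuple ((continuous_quad O i).fun_mul
    ((continuous_ampl (fun o : Option B => o.elim j r) (tens (Pi.single x 1) u)).star.fun_mul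
      (continuous_ampl (fun o : Option B => o.elim j r) (tens (fun y => O y x) v)))),
    Finset.mul_sum, ← colorCount_option]
  simp only [mul_integral_quad, rowOp_tens]
  simp only [integral_quad_eq_sum_pair]
  have h1 : ∀ x, O.trace • tens (fun y => O y x) v + (tens (fun y => O y x) (rowOp r O i v) +
      if j = i then tens (O.mulVec fun y => O y x) v else 0) =
      tens (fun y => O y x) (O.trace • v + rowOp r O i v) +
        if j = i then tens (fun y => (O * O) y x) v else 0 := by
    intro x
    have : (O.mulVec fun y => O y x) = fun y => (O * O) y x := rfl
    rw [this, ← add_assoc]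
    congr 1
    ext a
    simp only [tens, Pi.add_apply, Pi.smul_apply, smul_eq_mul]
    ring
  simp only [h1, pair_add_right, Finset.sum_add_distrib]
  congr 1
  split_ifs
  · rfl
  · simp [pair_eq_sum]

end RowSymShadow

end

noncomputable section

namespace RowSymShadow

variable {k d : ℕ} {B : Type} [Fintype B] [DecidableEq B]

/-! ### Norm bounds for local operators -/

/-- The Euclidean norm of a tensor. -/
def l2 {ι : Type} [Fintype ι] (v : ι → ℂ) : ℝ := ‖(WithLp.toLp 2 v : EuclideanSpace ℂ ι)‖

lemma l2_sq {ι : Type} [Fintype ι] (v : ι → ℂ) : l2 v ^ 2 = ∑ a, ‖v a‖ ^ 2 := by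
  simp [l2, EuclideanSpace.norm_sq_eq]

lemma l2_nonneg {ι : Type} [Fintype ι] (v : ι → ℂ) : 0 ≤ l2 v := norm_nonneg _

lemma norm_star_dotProduct_le {ι : Type} [Fintype ι] (u v : ι → ℂ) :
    ‖star u ⬝ᵥ v‖ ≤ l2 u * l2 v := by
  have h := norm_inner_le_norm (𝕜 := ℂ) (WithLp.toLp 2 u : EuclideanSpace ℂ ι) (WithLp.toLp 2 v)
  rwa [EuclideanSpace.inner_eq_star_dotProduct, dotProduct_comm] at h

lemma specNorm_nonneg (O : Matrix (Fin d) (Fin d) ℂ) : 0 ≤ specNorm O := norm_nonneg _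

lemma l2_mulVec_le (O : Matrix (Fin d) (Fin d) ℂ) (z : Fin d → ℂ) :
    l2 (O.mulVec z) ≤ specNorm O * l2 z :=
  (Matrix.toEuclideanCLM (𝕜 := ℂ) O).le_opNorm (WithLp.toLp 2 z)

/-- Along each fibre in the coordinate `p` this is the matrix bound. Summing over all `a` counts
every fibre `d` times, a factor that cancels. -/
lemma l2_siteOp_le [NeZero d] (O : Matrix (Fin d) (Fin d) ℂ) (p : B) (v : (B → Fin d) → ℂ) :
    l2 (siteOp O p v) ≤ specNorm O * l2 v := by
  have hd : (0 : ℝ) < d := Nat.cast_pos.2 (NeZero.pos d)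
  have hswap : ∀ F : (B → Fin d) → ℝ, ∑ a, ∑ y, F (Function.update a p y) = d * ∑ a, F a := by
    intro F
    rw [← sum_update_swap p fun a _ => F a]
    simp [Finset.mul_sum]
  refine le_of_sq_le_sq ?_ (mul_nonneg (specNorm_nonneg O) (l2_nonneg v))
  rw [mul_pow, l2_sq, l2_sq]
  refine le_of_mul_le_mul_left ?_ hd
  rw [← hswap, mul_left_comm, ← hswap fun a => ‖v a‖ ^ 2, Finset.mul_sum]
  refine Finset.sum_le_sum fun a _ => ?_
  have h := pow_le_pow_left₀ (l2_nonneg _)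
    (l2_mulVec_le O fun x => v (Function.update a p x)) 2
  rw [mul_pow, l2_sq, l2_sq] at h
  simpa [siteOp, Matrix.mulVec, dotProduct] using h

/-- The sum of the operators `O_p` over all tensor factors `p`. -/
def totalOp (O : Matrix (Fin d) (Fin d) ℂ) (v : (B → Fin d) → ℂ) : (B → Fin d) → ℂ :=
  ∑ p, siteOp O p v

lemma l2_totalOp_le [NeZero d] (O : Matrix (Fin d) (Fin d) ℂ) (v : (B → Fin d) → ℂ) :
    l2 (totalOp O v) ≤ Fintype.card B * specNorm O * l2 v := by
  have h : l2 (totalOp O v) ≤ ∑ p : B, l2 (siteOp O p v) := by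
    unfold l2 totalOp
    rw [WithLp.toLp_sum]
    exact norm_sum_le _ _
  refine h.trans ((Finset.sum_le_sum fun p _ => l2_siteOp_le O p v).trans_eq ?_)
  simp [mul_assoc]

lemma sum_rowOp (r : B → Fin k) (O : Matrix (Fin d) (Fin d) ℂ) (v : (B → Fin d) → ℂ) :
    ∑ i, rowOp r O i v = totalOp O v := by
  unfold rowOp totalOp
  rw [Finset.sum_comm]
  simp

omit [Fintype B] in
lemma siteOp_comp_perm {r : B → Fin k} {v : (B → Fin d) → ℂ} (hv : ColorSym r v)
    (O : Matrix (Fin d) (Fin d) ℂ) (p : B) (σ : Equiv.Perm B) (hσ : ∀ b, r (σ b) = r b)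
    (a : B → Fin d) : siteOp O p v (a ∘ σ) = siteOp O (σ p) v a := by
  refine Finset.sum_congr rfl fun x _ => ?_
  rw [← hv σ hσ (Function.update a (σ p) x)]
  congr 2
  ext b
  by_cases hb : b = p
  · subst hb; simp
  · simp [hb]

/-- A color-preserving permutation merely permutes the summands `O_p`. This lets the reproducing
property be applied after insertions. -/
lemma ColorSym.rowOp {r : B → Fin k} {v : (B → Fin d) → ℂ} (hv : ColorSym r v)
    (O : Matrix (Fin d) (Fin d) ℂ) (i : Fin k) : ColorSym r (rowOp r O i v) := by
  intro σ hσ a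
  simp only [RowSymShadow.rowOp, Finset.sum_apply]
  rw [← Equiv.sum_comp σ fun p => (if r p = i then siteOp O p v else 0) a]
  refine Finset.sum_congr rfl fun p _ => ?_
  rw [hσ]
  split_ifs
  · exact siteOp_comp_perm hv O p σ hσ a
  · rfl

omit [Fintype B] [DecidableEq B] in
lemma ColorSym.smul_add {r : B → Fin k} {v w : (B → Fin d) → ℂ} (hv : ColorSym r v)
    (hw : ColorSym r w) (c : ℂ) : ColorSym r (c • v + w) := by
  intro σ hσ a
  simp [hv σ hσ a, hw σ hσ a]

omit [Fintype B] in
lemma siteOp_add (O : Matrix (Fin d) (Fin d) ℂ) (p : B) (v w : (B → Fin d) → ℂ) :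
    siteOp O p (v + w) = siteOp O p v + siteOp O p w := by
  ext a; simp [siteOp, mul_add, Finset.sum_add_distrib]

omit [Fintype B] in
lemma siteOp_smul (O : Matrix (Fin d) (Fin d) ℂ) (p : B) (c : ℂ) (v : (B → Fin d) → ℂ) :
    siteOp O p (c • v) = c • siteOp O p v := by
  ext a; simp [siteOp, Finset.mul_sum, mul_left_comm]

lemma totalOp_add (O : Matrix (Fin d) (Fin d) ℂ) (v w : (B → Fin d) → ℂ) :
    totalOp O (v + w) = totalOp O v + totalOp O w := by
  simp [totalOp, siteOp_add, Finset.sum_add_distrib]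

lemma totalOp_smul (O : Matrix (Fin d) (Fin d) ℂ) (c : ℂ) (v : (B → Fin d) → ℂ) :
    totalOp O (c • v) = c • totalOp O v := by
  simp [totalOp, siteOp_smul, Finset.smul_sum]

/-- The operator `tr O + ∑_p O_p`, the sum running over the tensor factors of color `i`. -/
def shiftOp (r : B → Fin k) (O : Matrix (Fin d) (Fin d) ℂ) (i : Fin k) (v : (B → Fin d) → ℂ) :
    (B → Fin d) → ℂ := O.trace • v + rowOp r O i v

/-- Summed over the rows, the operators no longer depend on the coloring. -/
lemma sum_shiftOp (r : B → Fin k) (O : Matrix (Fin d) (Fin d) ℂ) (v : (B → Fin d) → ℂ) :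
    ∑ i, shiftOp r O i v = ((k : ℂ) * O.trace) • v + totalOp O v := by
  simp [shiftOp, Finset.sum_add_distrib, sum_rowOp, ← Nat.cast_smul_eq_nsmul ℂ, smul_smul]

lemma shiftOp_sum (r : B → Fin k) (O : Matrix (Fin d) (Fin d) ℂ) (j : Fin k)
    (v : Fin k → (B → Fin d) → ℂ) :
    shiftOp r O j (∑ i, v i) = ∑ i, shiftOp r O j (v i) := by
  have hs : ∀ p, siteOp O p (∑ i, v i) = ∑ i, siteOp O p (v i) := fun p => by
    ext a; simp only [siteOp, Finset.sum_apply, Finset.mul_sum]; exact Finset.sum_comm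
  simp only [shiftOp, rowOp, hs, Finset.sum_add_distrib, Finset.smul_sum]
  congr 1
  rw [Finset.sum_comm]
  exact Finset.sum_congr rfl fun p _ => by split_ifs <;> simp

/-! ### The variance of the estimator in terms of amplitudes -/

section
variable [NeZero d]

/-- The outcome density `∏ κ · |⟨⨂ φ | v⟩|²`. -/
def dens (r : B → Fin k) (v : (B → Fin d) → ℂ) (U : Fin k → Matrix.unitaryGroup (Fin d) ℂ) : ℝ :=
  ((∏ i, symDim d (colorCount r i) : ℕ) : ℝ) * ‖ampl r v U‖ ^ 2

lemma continuous_dens (r : B → Fin k) (v : (B → Fin d) → ℂ) : Continuous (dens r v) :=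
  continuous_const.mul ((continuous_ampl r v).norm.pow 2)

lemma dens_nonneg (r : B → Fin k) (v : (B → Fin d) → ℂ)
    (U : Fin k → Matrix.unitaryGroup (Fin d) ℂ) : 0 ≤ dens r v U :=
  mul_nonneg (Nat.cast_nonneg _) (sq_nonneg _)

lemma ofReal_dens (r : B → Fin k) (v : (B → Fin d) → ℂ)
    (U : Fin k → Matrix.unitaryGroup (Fin d) ℂ) :
    (dens r v U : ℂ) =
      ((∏ i, symDim d (colorCount r i) : ℕ) : ℂ) * (star (ampl r v U) * ampl r v U) := by
  have h : star (ampl r v U) * ampl r v U = ((‖ampl r v U‖ ^ 2 : ℝ) : ℂ) := by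
    rw [mul_comm]
    simpa using Complex.mul_conj' (ampl r v U)
  rw [h, dens]
  push_cast
  rfl

lemma ofReal_re_quad {O : Matrix (Fin d) (Fin d) ℂ} (hO : O.IsHermitian) (i : Fin k)
    (U : Fin k → Matrix.unitaryGroup (Fin d) ℂ) : (((quad O i U).re : ℝ) : ℂ) = quad O i U := by
  refine Complex.conj_eq_iff_re.1 ?_
  rw [← Complex.star_def, quad]
  simp only [star_sum, star_mul', star_star]
  rw [Finset.sum_comm]
  refine Finset.sum_congr rfl fun y _ => Finset.sum_congr rfl fun x _ => ?_
  rw [hO.apply]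
  ring

lemma star_dotProduct_self {ι : Type} [Fintype ι] {v : ι → ℂ} (hn : ∑ a, ‖v a‖ ^ 2 = 1) :
    star v ⬝ᵥ v = 1 := by
  have h : ∀ a, star v a * v a = ((‖v a‖ ^ 2 : ℝ) : ℂ) := fun a => by
    rw [mul_comm]
    simpa using Complex.mul_conj' (v a)
  simp only [dotProduct, h]
  rw [← Complex.ofReal_sum, hn, Complex.ofReal_one]

lemma integral_dens {r : B → Fin k} {v : (B → Fin d) → ℂ} (hv : ColorSym r v)
    (hn : ∑ a, ‖v a‖ ^ 2 = 1) : ∫ U, dens r v U ∂haarTuple k d = 1 := by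
  have h := prod_symDim_mul_pair r v hv
  rw [pair, ← integral_const_mul] at h
  simp only [← ofReal_dens] at h
  rw [integral_complex_ofReal] at h
  exact Complex.ofReal_injective (h.trans (star_dotProduct_self hn))

lemma mul_integral_dens_quad {r : B → Fin k} {v : (B → Fin d) → ℂ} (hv : ColorSym r v)
    {O : Matrix (Fin d) (Fin d) ℂ} (hO : O.IsHermitian) (i : Fin k) :
    ((((d : ℝ) + colorCount r i) * ∫ U, dens r v U * (quad O i U).re ∂haarTuple k d : ℝ) : ℂ) =
      star v ⬝ᵥ shiftOp r O i v := by
  have h := mul_integral_quad r O i v v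
  have h2 := prod_symDim_mul_pair r v (hv.smul_add (hv.rowOp O i) O.trace)
  rw [← h, mul_left_comm, ← integral_const_mul] at h2
  refine Eq.trans ?_ h2
  rw [Complex.ofReal_mul, Complex.ofReal_add, Complex.ofReal_natCast, Complex.ofReal_natCast,
    ← integral_complex_ofReal]
  congr 2
  ext U
  rw [Complex.ofReal_mul, ofReal_dens, ofReal_re_quad hO]
  ring

lemma mul_integral_dens_quad_quad {r : B → Fin k} {v : (B → Fin d) → ℂ} (hv : ColorSym r v)
    {O : Matrix (Fin d) (Fin d) ℂ} (hO : O.IsHermitian) (i j : Fin k) :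
    ((((d : ℝ) + colorCount r j) * (((d : ℝ) + (colorCount r i + if j = i then 1 else 0 : ℕ)) *
      ∫ U, dens r v U * ((quad O i U).re * (quad O j U).re) ∂haarTuple k d) : ℝ) : ℂ) =
      star v ⬝ᵥ shiftOp r O j (shiftOp r O i v) +
        if j = i then star v ⬝ᵥ shiftOp r (O * O) j v else 0 := by
  have h := mul_integral_quad_quad r O i j v v
  have hs := hv.smul_add (hv.rowOp O i) O.trace
  have h1 := prod_symDim_mul_pair r v (hs.smul_add (hs.rowOp O j) O.trace)
  have h2 := prod_symDim_mul_pair r v (hv.smul_add (hv.rowOp (O * O) j) (O * O).trace)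
  rw [← mul_integral_quad] at h1 h2
  have hl : ((∫ U, dens r v U * ((quad O i U).re * (quad O j U).re) ∂haarTuple k d : ℝ) : ℂ) =
      ((∏ i, symDim d (colorCount r i) : ℕ) : ℂ) * ∫ U, quad O i U * (quad O j U *
        (star (ampl r v U) * ampl r v U)) ∂haarTuple k d := by
    rw [← integral_complex_ofReal, ← integral_const_mul]
    congr 1
    ext U
    rw [Complex.ofReal_mul, Complex.ofReal_mul, ofReal_dens, ofReal_re_quad hO,
      ofReal_re_quad hO]
    ring
  rw [Complex.ofReal_mul, Complex.ofReal_mul, hl, Complex.ofReal_add, Complex.ofReal_add,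
    Complex.ofReal_natCast, Complex.ofReal_natCast, Complex.ofReal_natCast,
    mul_left_comm ((d : ℂ) + _) ((∏ i, symDim d (colorCount r i) : ℕ) : ℂ), h]
  change _ = star v ⬝ᵥ shiftOp r O j (shiftOp r O i v) at h1
  change _ = star v ⬝ᵥ shiftOp r (O * O) j v at h2
  rw [← h1, ← h2]
  split_ifs <;> ring

/-- The estimator `∑_i (d + λ_i) ⟨φ_i | O | φ_i⟩`. -/
def est (r : B → Fin k) (O : Matrix (Fin d) (Fin d) ℂ)
    (U : Fin k → Matrix.unitaryGroup (Fin d) ℂ) : ℝ :=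
  ∑ i, ((d : ℝ) + colorCount r i) * (quad O i U).re

lemma continuous_re_quad (O : Matrix (Fin d) (Fin d) ℂ) (i : Fin k) :
    Continuous fun U : Fin k → Matrix.unitaryGroup (Fin d) ℂ => (quad O i U).re :=
  Complex.continuous_re.comp (continuous_quad O i)

omit [DecidableEq B] in
lemma continuous_est (r : B → Fin k) (O : Matrix (Fin d) (Fin d) ℂ) : Continuous (est r O) :=
  continuous_finsetSum _ fun i _ => continuous_const.mul (continuous_re_quad O i)

lemma integral_dens_est {r : B → Fin k} {v : (B → Fin d) → ℂ} (hv : ColorSym r v)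
    (hn : ∑ a, ‖v a‖ ^ 2 = 1) {O : Matrix (Fin d) (Fin d) ℂ} (hO : O.IsHermitian) :
    ((∫ U, dens r v U * est r O U ∂haarTuple k d : ℝ) : ℂ) =
      k * O.trace + star v ⬝ᵥ totalOp O v := by
  have h : ∀ U : Fin k → Matrix.unitaryGroup (Fin d) ℂ, dens r v U * est r O U =
      ∑ i, ((d : ℝ) + colorCount r i) * (dens r v U * (quad O i U).re) := fun U => by
    rw [est, Finset.mul_sum]
    exact Finset.sum_congr rfl fun i _ => by ring
  simp only [h]
  rw [integral_finsetSum _ fun i _ => (integrable_haarTuple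
    ((continuous_dens r v).fun_mul (continuous_re_quad O i))).const_mul _, Complex.ofReal_sum]
  simp only [integral_const_mul, mul_integral_dens_quad hv hO]
  rw [← dotProduct_sum, sum_shiftOp, dotProduct_add, dotProduct_smul, star_dotProduct_self hn,
    smul_eq_mul, mul_one]

lemma integral_dens_est_sq_le {r : B → Fin k} {v : (B → Fin d) → ℂ} (hv : ColorSym r v)
    (hn : ∑ a, ‖v a‖ ^ 2 = 1) {O : Matrix (Fin d) (Fin d) ℂ} (hO : O.IsHermitian) :
    ∫ U, dens r v U * est r O U ^ 2 ∂haarTuple k d ≤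
      ((k * O.trace) ^ 2 + 2 * (k * O.trace) * (star v ⬝ᵥ totalOp O v) +
        star v ⬝ᵥ totalOp O (totalOp O v) +
        (k * (O * O).trace + star v ⬝ᵥ totalOp (O * O) v) : ℂ).re := by
  have h : ∀ U : Fin k → Matrix.unitaryGroup (Fin d) ℂ, dens r v U * est r O U ^ 2 =
      ∑ i, ∑ j, ((d : ℝ) + colorCount r j) * (((d : ℝ) + colorCount r i) *
        (dens r v U * ((quad O i U).re * (quad O j U).re))) := fun U => by
    rw [est, sq, Finset.sum_mul_sum, Finset.mul_sum]
    refine Finset.sum_congr rfl fun i _ => ?_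
    rw [Finset.mul_sum]
    exact Finset.sum_congr rfl fun j _ => by ring
  have hint : ∀ i j : Fin k, Integrable (fun U => ((d : ℝ) + colorCount r j) *
      (((d : ℝ) + colorCount r i) *
        (dens r v U * ((quad O i U).re * (quad O j U).re)))) (haarTuple k d) := fun i j =>
    ((integrable_haarTuple ((continuous_dens r v).fun_mul ((continuous_re_quad O i).fun_mul
      (continuous_re_quad O j)))).const_mul _).const_mul _
  have hij : ∀ i j : Fin k, ∫ U, ((d : ℝ) + colorCount r j) * (((d : ℝ) + colorCount r i) *
      (dens r v U * ((quad O i U).re * (quad O j U).re))) ∂haarTuple k d ≤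
      (star v ⬝ᵥ shiftOp r O j (shiftOp r O i v) +
        if j = i then star v ⬝ᵥ shiftOp r (O * O) j v else 0).re := by
    intro i j
    rw [← mul_integral_dens_quad_quad hv hO, Complex.ofReal_re, integral_const_mul,
      integral_const_mul]
    refine mul_le_mul_of_nonneg_left ?_ (by positivity)
    -- For `j = i` the exact factor is `d + λ_i + 1`, and lowering it to `d + λ_i` is harmless
    -- because the integrand is a nonnegative density times a square. For `j ≠ i` equality holds.
    by_cases hji : j = i
    · subst hji
      refine mul_le_mul_of_nonneg_right (by simp) (integral_nonneg fun U => ?_)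
      exact mul_nonneg (dens_nonneg r v U) (mul_self_nonneg _)
    · simp [hji]
  simp only [h]
  rw [integral_finsetSum _ fun i _ => integrable_finsetSum _ fun j _ => hint i j]
  simp only [integral_finsetSum _ fun j _ => hint _ j]
  refine (Finset.sum_le_sum fun i _ => Finset.sum_le_sum fun j _ => hij i j).trans_eq ?_
  simp only [← Complex.re_sum]
  congr 1
  simp only [Finset.sum_add_distrib, Finset.sum_ite_eq', Finset.mem_univ, if_true,
    ← dotProduct_sum]
  rw [Finset.sum_comm]
  simp only [← shiftOp_sum, sum_shiftOp]
  simp only [totalOp_add, totalOp_smul, dotProduct_add, dotProduct_smul, star_dotProduct_self hn,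
    smul_eq_mul, mul_one]
  ring

theorem dens_variance_le {r : B → Fin k} {v : (B → Fin d) → ℂ} (hv : ColorSym r v)
    (hn : ∑ a, ‖v a‖ ^ 2 = 1) {O : Matrix (Fin d) (Fin d) ℂ} (hO : O.IsHermitian) :
    ∫ U, dens r v U * est r O U ^ 2 ∂haarTuple k d -
        (∫ U, dens r v U * est r O U ∂haarTuple k d) ^ 2 ≤
      k * (O * O).trace.re + Fintype.card B * specNorm (O * O) +
        (Fintype.card B : ℝ) ^ 2 * specNorm O ^ 2 := by
  have hl2 : l2 v = 1 := by
    have := l2_sq v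
    rw [hn] at this
    exact (pow_eq_one_iff_of_nonneg (l2_nonneg v) two_ne_zero).1 this
  have hE := integral_dens_est hv hn hO
  have hE2 := integral_dens_est_sq_le hv hn hO
  have hT : ((O.trace.re : ℝ) : ℂ) = O.trace := by
    refine Complex.conj_eq_iff_re.1 ?_
    rw [← Complex.star_def, ← Matrix.trace_conjTranspose, hO.eq]
  set m := ∫ U, dens r v U * est r O U ∂haarTuple k d
  have hS : star v ⬝ᵥ totalOp O v = ((m - k * O.trace.re : ℝ) : ℂ) := by
    push_cast
    rw [hE, hT]
    ring
  have h1 : (star v ⬝ᵥ totalOp O (totalOp O v)).re ≤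
      (Fintype.card B : ℝ) ^ 2 * specNorm O ^ 2 := by
    refine (Complex.re_le_norm _).trans ((norm_star_dotProduct_le _ _).trans ?_)
    have ha := l2_totalOp_le O v
    have hb := l2_totalOp_le O (totalOp O v)
    rw [hl2, mul_one] at ha
    rw [hl2, one_mul]
    refine hb.trans ((mul_le_mul_of_nonneg_left ha
      (mul_nonneg (Nat.cast_nonneg _) (specNorm_nonneg O))).trans_eq ?_)
    ring
  have h2 : (star v ⬝ᵥ totalOp (O * O) v).re ≤ Fintype.card B * specNorm (O * O) := by
    refine (Complex.re_le_norm _).trans ((norm_star_dotProduct_le _ _).trans ?_)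
    simpa [hl2] using l2_totalOp_le (O * O) v
  have hkT : (k : ℂ) * O.trace = ((k * O.trace.re : ℝ) : ℂ) := by
    rw [Complex.ofReal_mul, hT, Complex.ofReal_natCast]
  rw [hS, hkT] at hE2
  have h3 : (((k * O.trace.re : ℝ) : ℂ) ^ 2 + 2 * ((k * O.trace.re : ℝ) : ℂ) *
      ((m - k * O.trace.re : ℝ) : ℂ)) =
      (((k * O.trace.re) ^ 2 + 2 * (k * O.trace.re) * (m - k * O.trace.re) : ℝ) : ℂ) := by
    push_cast
    ring
  rw [h3, Complex.add_re, Complex.add_re, Complex.add_re, Complex.ofReal_re] at hE2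
  have h4 : ((k : ℂ) * (O * O).trace).re = k * (O * O).trace.re := by simp
  rw [h4] at hE2
  -- With `t = k tr O` and mean `m`, `t² + 2t(m - t) = m² - (m - t)² ≤ m²`.
  nlinarith [sq_nonneg (m - k * O.trace.re)]

end

end RowSymShadow

end

noncomputable section

namespace RowSymShadow

variable {k d : ℕ} {B : Type} [Fintype B] [DecidableEq B]

/-! ### Permutation operators and row symmetry -/

lemma permOp_mulVec (π : Equiv.Perm B) (v : QuditSpace B d) (a : B → Fin d) :
    (permOp π).mulVec v a = v (a ∘ π) := by
  have h : ∀ a', (a = a' ∘ π.symm) ↔ (a ∘ π = a') := fun a' =>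
    ⟨by rintro rfl; ext b; simp, by rintro rfl; ext b; simp⟩
  simp [Matrix.mulVec, dotProduct, permOp, h]

lemma permOp_mul (π σ : Equiv.Perm B) :
    (permOp π : QuditOp B d) * permOp σ = permOp (π * σ) := by
  refine Matrix.mulVec_injective (funext fun v => ?_)
  rw [← Matrix.mulVec_mulVec]
  ext a
  rw [permOp_mulVec, permOp_mulVec, permOp_mulVec]
  rfl

variable {lam : Fin k → ℕ}

lemma mem_rowGroup {π : Equiv.Perm (Box lam)} : π ∈ rowGroup lam ↔ ∀ b, (π b).1 = b.1 := by
  simp [rowGroup]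

lemma permOp_mul_sum_rowGroup {π : Equiv.Perm (Box lam)} (hπ : π ∈ rowGroup lam) :
    (permOp π : QuditOp (Box lam) d) * ∑ σ ∈ rowGroup lam, permOp σ =
      ∑ σ ∈ rowGroup lam, permOp σ := by
  rw [Finset.mul_sum]
  simp only [permOp_mul]
  refine Finset.sum_equiv (Equiv.mulLeft π) (fun σ => ?_) fun σ _ => rfl
  rw [mem_rowGroup] at hπ
  simp [mem_rowGroup, hπ]

/-- The row sum is the left factor of the Young symmetrizer and absorbs every row permutation. -/
lemma range_youngSymmetrizer_le :
    LinearMap.range (youngSymmetrizer lam d).mulVecLin ≤ rowSymSpace lam d := by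
  rintro _ ⟨v, rfl⟩ π hπ
  rw [Matrix.mulVecLin_apply, Matrix.mulVec_mulVec, youngSymmetrizer, ← Matrix.mul_assoc,
    permOp_mul_sum_rowGroup hπ]

lemma colorSym_of_mem_rowSymSpace {v : QuditSpace (Box lam) d} (hv : v ∈ rowSymSpace lam d) :
    ColorSym (Sigma.fst : Box lam → Fin k) v := by
  intro σ hσ a
  rw [← permOp_mulVec σ v a, hv σ (mem_rowGroup.2 hσ)]

lemma colorCount_fst (lam : Fin k → ℕ) (i : Fin k) :
    colorCount (Sigma.fst : Box lam → Fin k) i = lam i := by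
  rw [colorCount, Finset.card_filter, Fintype.sum_sigma, Finset.sum_eq_single i]
  · simp
  · intro j _ hj
    simp [hj]
  · simp

lemma rowSymProj_mulVec {v : QuditSpace (Box lam) d}
    (hv : ColorSym (Sigma.fst : Box lam → Fin k) v) : (rowSymProj lam d).mulVec v = v := by
  have hc : ((rowGroup lam).card : ℂ) ≠ 0 :=
    Nat.cast_ne_zero.2 (Finset.card_ne_zero_of_mem (mem_rowGroup.2 fun b => rfl :
      (1 : Equiv.Perm (Box lam)) ∈ rowGroup lam))
  rw [rowSymProj, Matrix.smul_mulVec, Matrix.sum_mulVec]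
  have h : ∀ π ∈ rowGroup lam, (permOp π).mulVec v = v := fun π hπ => by
    ext a
    rw [permOp_mulVec, hv π (mem_rowGroup.1 hπ)]
  rw [Finset.sum_congr rfl h, Finset.sum_const, ← Nat.cast_smul_eq_nsmul ℂ,
    inv_smul_smul₀ hc]

/-! ### Rotations of the state -/

lemma tensorOp_mul (M N : B → Matrix (Fin d) (Fin d) ℂ) :
    tensorOp M * tensorOp N = tensorOp fun b => M b * N b := by
  ext a a'
  simp only [Matrix.mul_apply, tensorOp, Matrix.of_apply, Finset.prod_univ_sum,
    Fintype.piFinset_univ, Finset.prod_mul_distrib]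

omit [DecidableEq B] in
lemma tensorOp_one : tensorOp (fun _ : B => (1 : Matrix (Fin d) (Fin d) ℂ)) = 1 := by
  ext a a'
  simp [tensorOp, Matrix.one_apply, Finset.prod_ite_zero, funext_iff]

omit [DecidableEq B] in
lemma conjTranspose_tensorOp (M : B → Matrix (Fin d) (Fin d) ℂ) :
    (tensorOp M).conjTranspose = tensorOp fun b => (M b).conjTranspose := by
  ext a a'
  simp [tensorOp, Matrix.conjTranspose_apply]

lemma sum_norm_sq_eq_dotProduct {ι : Type} [Fintype ι] (v : ι → ℂ) :
    ((∑ a, ‖v a‖ ^ 2 : ℝ) : ℂ) = star v ⬝ᵥ v := by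
  rw [Complex.ofReal_sum, dotProduct]
  refine Finset.sum_congr rfl fun a _ => ?_
  rw [mul_comm]
  simpa using (Complex.mul_conj' (v a)).symm

lemma sum_norm_sq_tensorOp_mulVec (U : Matrix.unitaryGroup (Fin d) ℂ) (τ : QuditSpace B d) :
    ∑ a, ‖(tensorOp fun _ : B => (U : Matrix (Fin d) (Fin d) ℂ)).mulVec τ a‖ ^ 2 =
      ∑ a, ‖τ a‖ ^ 2 := by
  refine Complex.ofReal_injective ?_
  rw [sum_norm_sq_eq_dotProduct, sum_norm_sq_eq_dotProduct, Matrix.star_mulVec,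
    ← Matrix.dotProduct_mulVec, Matrix.mulVec_mulVec, conjTranspose_tensorOp, tensorOp_mul]
  have h : (U : Matrix (Fin d) (Fin d) ℂ).conjTranspose * U = 1 :=
    Matrix.mem_unitaryGroup_iff'.1 U.2
  simp only [h, tensorOp_one, Matrix.one_mulVec]

/-- The same matrix acts on every factor, so it commutes with permutations of the boxes. -/
lemma ColorSym.tensorOp_mulVec {r : B → Fin k} {τ : QuditSpace B d} (hτ : ColorSym r τ)
    (M : Matrix (Fin d) (Fin d) ℂ) : ColorSym r ((tensorOp fun _ : B => M).mulVec τ) := by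
  intro σ hσ a
  simp only [Matrix.mulVec, dotProduct, tensorOp, Matrix.of_apply]
  refine Fintype.sum_equiv (σ.arrowCongr (Equiv.refl (Fin d))) _ _ fun c => ?_
  rw [← hτ σ hσ (σ.arrowCongr (Equiv.refl (Fin d)) c),
    ← Equiv.prod_comp σ fun b => M (a b) (σ.arrowCongr (Equiv.refl (Fin d)) c b)]
  simp [Function.comp_def]

/-! ### The outcome law -/

section
variable [NeZero d]

/-- The tuple of random pure states `U_i |0⟩⟨0| U_i†`. -/
def pureStates (U : Fin k → Matrix.unitaryGroup (Fin d) ℂ) (i : Fin k) :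
    Matrix (Fin d) (Fin d) ℂ :=
  (U i : Matrix (Fin d) (Fin d) ℂ) * ketbra (Pi.single (0 : Fin d) 1) *
    (U i : Matrix (Fin d) (Fin d) ℂ).conjTranspose

lemma pureStates_apply (U : Fin k → Matrix.unitaryGroup (Fin d) ℂ) (i : Fin k) (x y : Fin d) :
    pureStates U i x y = hvec U i x * star (hvec U i y) := by
  rw [pureStates, ketbra, Matrix.mul_vecMulVec, Matrix.vecMulVec_mul, Matrix.vecMulVec_apply,
    Matrix.mulVec_single_one, ← Matrix.star_mulVec, Matrix.mulVec_single_one]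
  rfl

lemma continuous_conj_ketbra : Continuous fun U : Matrix.unitaryGroup (Fin d) ℂ =>
    (U : Matrix (Fin d) (Fin d) ℂ) * ketbra (Pi.single (0 : Fin d) 1) *
      (U : Matrix (Fin d) (Fin d) ℂ).conjTranspose :=
  (continuous_subtype_val.matrix_mul continuous_const).matrix_mul
    continuous_subtype_val.matrix_conjTranspose

lemma measurable_pureStates : Measurable (pureStates (k := k) (d := d)) :=
  measurable_pi_lambda _ fun i =>
    continuous_conj_ketbra.measurable.comp (measurable_pi_apply i)

lemma pi_haarState : (Measure.pi fun _ : Fin k => haarState d) =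
    (haarTuple k d).map pureStates := by
  unfold haarState haarTuple
  have (i : Fin k) : SigmaFinite ((haarUnitary d).map fun U : Matrix.unitaryGroup (Fin d) ℂ =>
      (U : Matrix (Fin d) (Fin d) ℂ) * ketbra (Pi.single (0 : Fin d) 1) *
        (U : Matrix (Fin d) (Fin d) ℂ).conjTranspose) := by
    have := Measure.isProbabilityMeasure_map (μ := haarUnitary d)
      (continuous_conj_ketbra (d := d)).aemeasurable
    infer_instance
  exact (Measure.pi_map_pi fun i : Fin k =>
    (continuous_conj_ketbra (d := d)).aemeasurable).symm

lemma trace_povmElement_mul_ketbra (v : QuditSpace (Box lam) d)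
    (U : Fin k → Matrix.unitaryGroup (Fin d) ℂ) :
    (povmElement lam (pureStates U) * ketbra v).trace = (dens Sigma.fst v U : ℂ) := by
  rw [ofReal_dens, povmElement, Matrix.smul_mul, Matrix.trace_smul, smul_eq_mul]
  simp only [colorCount_fst]
  congr 1
  rw [star_ampl_mul_ampl]
  simp only [Matrix.trace, Matrix.diag_apply, Matrix.mul_apply, tensorOp, Matrix.of_apply,
    ketbra, Matrix.vecMulVec_apply, pureStates_apply, Finset.prod_mul_distrib, Pi.star_apply]
  refine Finset.sum_congr rfl fun a _ => Finset.sum_congr rfl fun a' _ => ?_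
  ring

omit [NeZero d] in
lemma continuous_trace_povmElement (v : QuditSpace (Box lam) d) :
    Continuous fun ψ : Fin k → Matrix (Fin d) (Fin d) ℂ =>
      (povmElement lam ψ * ketbra v).trace.re := by
  refine Complex.continuous_re.comp (Continuous.matrix_trace
    (Continuous.matrix_mul ?_ continuous_const))
  exact Continuous.fun_const_smul (continuous_matrix fun a a' => continuous_finsetProd _ fun (b : Box lam) _ =>
    (continuous_apply b.1).matrix_elem _ _) _

/-- The law of the random unitaries, weighted by the outcome density. -/
def weightedHaar (lam : Fin k → ℕ) (v : QuditSpace (Box lam) d) :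
    Measure (Fin k → Matrix.unitaryGroup (Fin d) ℂ) :=
  (haarTuple k d).withDensity fun U => ENNReal.ofReal (dens (Sigma.fst : Box lam → Fin k) v U)

/-- The row projector fixes `v`, so the "fail" part vanishes. The rest is pulled back to the compact
group of unitary tuples, where every continuous function is integrable. -/
lemma outcomeLaw_ketbra {v : QuditSpace (Box lam) d}
    (hv : ColorSym (Sigma.fst : Box lam → Fin k) v) :
    outcomeLaw lam d (ketbra v) =
      (weightedHaar lam v).map fun U => Sum.inl (pureStates U) := by
  have h0 : (1 - rowSymProj lam d) * ketbra v = 0 := by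
    rw [ketbra, Matrix.mul_vecMulVec, Matrix.sub_mulVec, Matrix.one_mulVec, rowSymProj_mulVec hv,
      sub_self]
    ext a a'
    simp [Matrix.vecMulVec_apply]
  have h1 : ((haarTuple k d).map pureStates).withDensity (fun ψ =>
      ENNReal.ofReal (povmElement lam ψ * ketbra v).trace.re) =
      (weightedHaar lam v).map pureStates := by
    ext s hs
    rw [withDensity_apply _ hs, setLIntegral_map hs
      (continuous_trace_povmElement v).measurable.ennreal_ofReal measurable_pureStates,
      Measure.map_apply measurable_pureStates hs, weightedHaar,
      withDensity_apply _ (measurable_pureStates hs)]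
    simp only [trace_povmElement_mul_ketbra, Complex.ofReal_re]
  rw [outcomeLaw, h0, pi_haarState, h1, Measure.map_map measurable_inl measurable_pureStates]
  simp [Function.comp_def]

lemma trace_mul_pureStates (O : Matrix (Fin d) (Fin d) ℂ) (i : Fin k)
    (U : Fin k → Matrix.unitaryGroup (Fin d) ℂ) : (O * pureStates U i).trace = quad O i U := by
  simp only [Matrix.trace, Matrix.diag_apply, Matrix.mul_apply, pureStates_apply, quad]
  refine Finset.sum_congr rfl fun y _ => Finset.sum_congr rfl fun x _ => ?_
  ring

lemma trace_mul_estimator {O : Matrix (Fin d) (Fin d) ℂ} (hO : O.IsHermitian)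
    (U : Fin k → Matrix.unitaryGroup (Fin d) ℂ) :
    (O * estimator lam d (Sum.inl (pureStates U))).trace =
      (est (Sigma.fst : Box lam → Fin k) O U : ℂ) := by
  simp only [estimator, Matrix.mul_sum, Matrix.trace_sum, Matrix.mul_smul, Matrix.trace_smul,
    trace_mul_pureStates, est, Complex.ofReal_sum, Complex.ofReal_mul, ofReal_re_quad hO,
    colorCount_fst, Complex.ofReal_add, Complex.ofReal_natCast, smul_eq_mul]

omit [NeZero d] in
lemma measurable_trace_mul_estimator (O : Matrix (Fin d) (Fin d) ℂ) :
    Measurable fun ω : Outcome k d => (O * estimator lam d ω).trace := by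
  refine measurable_fun_sum ?_ (measurable_of_finite _)
  refine Continuous.measurable (Continuous.matrix_trace (continuous_const.matrix_mul ?_))
  exact continuous_finsetSum _ fun i _ => (continuous_apply i).fun_const_smul _

lemma isProbabilityMeasure_weightedHaar {v : QuditSpace (Box lam) d}
    (hv : ColorSym (Sigma.fst : Box lam → Fin k) v) (hn : ∑ a, ‖v a‖ ^ 2 = 1) :
    IsProbabilityMeasure (weightedHaar lam v) := by
  refine ⟨?_⟩
  rw [weightedHaar, withDensity_apply _ MeasurableSet.univ, Measure.restrict_univ,
    ← ofReal_integral_eq_lintegral_ofReal (integrable_haarTuple (continuous_dens _ v))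
      (Filter.Eventually.of_forall (dens_nonneg _ v)), integral_dens hv hn, ENNReal.ofReal_one]

lemma integral_weightedHaar (v : QuditSpace (Box lam) d)
    (g : (Fin k → Matrix.unitaryGroup (Fin d) ℂ) → ℝ) :
    ∫ U, g U ∂weightedHaar lam v =
      ∫ U, dens (Sigma.fst : Box lam → Fin k) v U * g U ∂haarTuple k d := by
  rw [weightedHaar, integral_withDensity_eq_integral_toReal_smul
    (continuous_dens _ v).measurable.ennreal_ofReal
    (Filter.Eventually.of_forall fun U => ENNReal.ofReal_lt_top)]
  simp only [ENNReal.toReal_ofReal (dens_nonneg _ v _), smul_eq_mul]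

end

end RowSymShadow

end

/-! ### Transfer of the variance bound to the outcome law -/

open RowSymShadow
theorem mainTheorem4 :
    ∃ C₁ C₂ : ℝ, ∀ (d n k : ℕ) [NeZero d] (lam : Fin k → ℕ),
      Antitone lam → (∀ i, 0 < lam i) → ∑ i, lam i = n → k ≤ d →
      LinearMap.range (youngSymmetrizer lam d).mulVecLin ≤ rowSymSpace lam d ∧
      ∀ (w : Fin d → ℕ) (τ : QuditSpace (Box lam) d) (U : Matrix.unitaryGroup (Fin d) ℂ)
        (O : Matrix (Fin d) (Fin d) ℂ) (P : Measure (Outcome k d)) (X : Outcome k d → ℝ),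
        τ ∈ weightSpace w → τ ∈ rowSymSpace lam d → ∑ a, ‖τ a‖ ^ 2 = 1 → O.IsHermitian →
        P = outcomeLaw lam d (rotatedState U τ) → X = traceEstimator lam O →
        IsProbabilityMeasure P ∧ P {Sum.inr ()} = 0 ∧
          (∀ᵐ ω ∂P, (O * estimator lam d ω).trace = (X ω : ℂ)) ∧
          MemLp X 2 P ∧
          variance X P = (∫ ω, X ω ^ 2 ∂P) - (∫ ω, X ω ∂P) ^ 2 ∧
          variance X P ≤ (k : ℝ) * (O * O).trace.re + C₁ * n * specNorm (O * O)
            + C₂ * (n : ℝ) ^ 2 * specNorm O ^ 2 := by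
  refine ⟨1, 1, fun d n k _ lam _ _ hlam _ => ⟨range_youngSymmetrizer_le, ?_⟩⟩
  intro w τ U O P X _ hτ hn hO hP hX
  set v := (tensorOp fun _ : Box lam => (U : Matrix (Fin d) (Fin d) ℂ)).mulVec τ with hvdef
  have hv : ColorSym (Sigma.fst : Box lam → Fin k) v :=
    (colorSym_of_mem_rowSymSpace hτ).tensorOp_mulVec _
  have hvn : ∑ a, ‖v a‖ ^ 2 = 1 := (sum_norm_sq_tensorOp_mulVec U τ).trans hn
  have hPmap : P = (weightedHaar lam v).map fun V => Sum.inl (pureStates V) := by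
    rw [hP, rotatedState, ← hvdef, outcomeLaw_ketbra hv]
  have hprob := isProbabilityMeasure_weightedHaar hv hvn
  have hG : Measurable fun V : Fin k → Matrix.unitaryGroup (Fin d) ℂ =>
      (Sum.inl (pureStates V) : Outcome k d) := measurable_inl.comp measurable_pureStates
  have hXG : ∀ V, X (Sum.inl (pureStates V)) = est (Sigma.fst : Box lam → Fin k) O V := fun V => by
    rw [hX, traceEstimator, trace_mul_estimator hO, Complex.ofReal_re]
  have hXm : Measurable X := by
    rw [hX]
    exact Complex.measurable_re.comp (measurable_trace_mul_estimator O)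
  have hPprob : IsProbabilityMeasure P := by
    rw [hPmap]
    exact Measure.isProbabilityMeasure_map hG.aemeasurable
  have hMem : MemLp X 2 P := by
    rw [hPmap, memLp_map_measure_iff hXm.aestronglyMeasurable hG.aemeasurable]
    -- On the compact group the estimator is continuous, hence bounded, hence square integrable.
    obtain ⟨C, hC⟩ := (isCompact_range
      (continuous_est (Sigma.fst : Box lam → Fin k) O)).isBounded.exists_norm_le
    refine MemLp.of_bound (hXm.comp hG).aestronglyMeasurable C
      (Filter.Eventually.of_forall fun V => ?_)
    rw [Function.comp_apply, hXG]
    exact hC _ ⟨V, rfl⟩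
  have hvar : variance X P = (∫ ω, X ω ^ 2 ∂P) - (∫ ω, X ω ∂P) ^ 2 := variance_eq_sub hMem
  refine ⟨hPprob, ?_, ?_, hMem, hvar, ?_⟩
  · have hs : MeasurableSet ({Sum.inr ()} : Set (Outcome k d)) := by
      rw [← Set.image_singleton]
      exact (measurableSet_singleton ()).inr_image
    rw [hPmap, Measure.map_apply hG hs]
    convert measure_empty (μ := weightedHaar lam v)
    ext V
    simp
  · have hs : MeasurableSet {ω : Outcome k d | (O * estimator lam d ω).trace = (X ω : ℂ)} :=
      measurableSet_eq_fun (measurable_trace_mul_estimator O)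
        (Complex.measurable_ofReal.comp hXm)
    rw [hPmap, ae_map_iff hG.aemeasurable hs]
    exact Filter.Eventually.of_forall fun V => by rw [hXG, trace_mul_estimator hO]
  · have hcard : Fintype.card (Box lam) = n := by simp [hlam]
    have h := dens_variance_le hv hvn hO
    rw [hcard] at h
    rw [hvar, hPmap, integral_map hG.aemeasurable (hXm.pow_const 2).aestronglyMeasurable,
      integral_map hG.aemeasurable hXm.aestronglyMeasurable]
    simp only [hXG, integral_weightedHaar]
    linarith
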